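/- **Setting.** Let $\mathcal H$ be a real reproducing kernel Hilbert space of dimension $d$ on a set $\mathcal X$, with kernel $k$, $k_x=k(\cdot,x)$, and let $\phi=(\phi_1,\dots,\phi_d)$ be an orthonormal basis of $\mathcal H$, so that each $f\in\mathcal H$ is $f=\langle\phi,\theta\rangle$ with coefficient vector $\theta\in\mathbb R^d$ and $\|f\|_{\mathcal H}=\|\theta\|$. There are $M\ge1$ clients; client $i$ holds data $(x_{ij},y_{ij})$, $1\le j\le n_i$, with $y_{ij}=f_i^*(x_{ij})+\xi_{ij}$, where $f_i^*\in\mathcal H$ has coefficients $\theta_i^*$. The covariates are random and, conditionally on them, the noise variables $\xi_{ij}$ are independent, centred, with variance at most $\sigma^2$; $\mathbb E_\xi$ is the expectation over the noise only. Put $N=\sum_i n_i$, $w_i=n_i/N$, $\Gamma=\max_{i,j}\|\theta_i^*-\theta_j^*\|$, $\ell_i(f)=\frac1{2n_i}\sum_j(f(x_{ij})-y_{ij})^2$. From an initial $f_0\in\mathcal H$ and with stepsize $\eta>0$, the global model is $f_t=\sum_i w_i f_{i,t}$, where for FedAvg $f_{i,t}=\mathcal G_i^s(f_{t-1})$ with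 $\mathcal G_i(f)=f-\eta\nabla\ell_i(f)$ and $s\ge1$, and for FedProx $f_{i,t}=\arg\min_f\{\ell_i(f)+\frac1{2\eta}\|f-f_{t-1}\|_{\mathcal H}^2\}$ (put $s=1$ in this case). Let $\theta_t$ be the coefficients of $f_t$. Let $\mathcal T_if=\frac1{n_i}\sum_j f(x_{ij})k_{x_{ij}}$ and $$\mathcal L=\sum_i w_i(I-\eta\mathcal T_i)^s,\quad \Psi_{ij}=\frac{\eta}{n_i}\sum_{\tau=0}^{s-1}(I-\eta\mathcal T_i)^\tau k_{x_{ij}}\quad\text{(FedAvg)},$$ $$\mathcal L=\sum_i w_i(I+\eta\mathcal T_i)^{-1},\quad \Psi_{ij}=\frac{\eta}{n_i}(I+\eta\mathcal T_i)^{-1}k_{x_{ij}}\quad\text{(FedProx)},$$ and, when $I-\mathcal L$ is invertible, let $\bar\theta$ be the coefficients of $\bar f=(I-\mathcal L)^{-1}\sum_i w_i\sum_j f_i^*(x_{ij})\Psi_{ij}$. Let $\gamma=\eta\max_i\|K_{\mathbf x_i}\|$, where $K_{\mathbf x_i}=\frac1{n_i}(k(x_{ij},x_{il}))_{j,l}$;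 for FedAvg assume $\gamma<1$ almost surely. Let $\kappa=\frac{\gamma s}{1-(1-\gamma)^s}$ for FedAvg and $\kappa=1+\gamma$ for FedProx. **Subspace model.** Let $r_i\ge1$ and suppose that almost surely the $n_i\times d$ matrix $\phi(\mathbf x_i)$ with rows $\phi(x_{ij})^\top$ equals $\sqrt{d/r_i}\,F_iU_i^\top$, where $U_i$ is a random $d\times r_i$ matrix with orthonormal columns, the subspaces spanned by the columns of $U_1,\dots,U_M$ are independent, and $\mathbb E[U_iU_i^\top]=\frac{r_i}{d}I_d$. Suppose that $\alpha,\beta>0$ and that almost surely $\lambda_{\min}(F_i^\top F_i/n_i)\ge\alpha$ and $\|F_i^\top F_i/n_i\|\le\beta$ for all $i$. **Statement.** There is a universal constant $C>0$ such that, if $N\ge C\nu d\log d$ with $\nu=\max_i n_i/r_i$, then with probability at least $1-1/d$ over the covariates the operator $I-\mathcal L$ is invertible, for all $t\ge0$ $$\mathbb E_\xi\|\theta_t-\bar\theta\|^2\le\Big(1-\frac{s\eta\alpha}{2\kappa}\Big)^{2t}\|\theta_0-\bar\theta\|^2+\sigma^2\frac{2\kappa d}{N\alpha},$$ and for all $j\in\{1,\dots,M\}$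 $$\|\bar\theta-\theta_j^*\|\le\Gamma\sqrt{\frac{2\kappa\beta\nu Md}{\alpha N}}.$$ -/

import Mathlib

set_option pp.deepTerms true

open MeasureTheory ProbabilityTheory

namespace FedLearn

/-- The two federated algorithms: FedAvg with `s` local gradient steps per round, and FedProx. -/
inductive Algorithm
  | fedAvg (s : ℕ)
  | fedProx

/-- The parameter `s` of the unified statement: the number of local steps for FedAvg,
and `1` for FedProx. -/
def Algorithm.localSteps : Algorithm → ℕ
  | .fedAvg s => s
  | .fedProx => 1

/-- `κ = γ s / (1 - (1 - γ) ^ s)` for FedAvg and `κ = 1 + γ` for FedProx. -/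
noncomputable def Algorithm.kappa (γ : ℝ) : Algorithm → ℝ
  | .fedAvg s => γ * s / (1 - (1 - γ) ^ s)
  | .fedProx => 1 + γ

/-- The spectral norm of a square real matrix, i.e. its operator norm on Euclidean space. -/
noncomputable def specNorm {m : ℕ} (A : Matrix (Fin m) (Fin m) ℝ) : ℝ :=
  ‖Matrix.toEuclideanCLM (n := Fin m) (𝕜 := ℝ) A‖

/-- The smallest (real) eigenvalue of a square matrix; used for symmetric matrices only. -/
noncomputable def minEigenvalue {m : ℕ} (A : Matrix (Fin m) (Fin m) ℝ) : ℝ :=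
  sInf (spectrum ℝ A)

/-- A minimizer of `J` (an arbitrary element if there is none). -/
noncomputable def argmin {H : Type*} [Nonempty H] (J : H → ℝ) : H :=
  Classical.epsilon fun f => IsMinOn J Set.univ f

section RKHS

variable {X H : Type*} [NormedAddCommGroup H] [InnerProductSpace ℝ H] [CompleteSpace H]
  [RKHS ℝ H X ℝ]

variable (H) in
/-- The representer `k_x = k(·, x)` of the evaluation at `x`. -/
noncomputable def rep (x : X) : H := RKHS.kerFun H x (1 : ℝ)

/-! ### One client with `m` data points -/

variable (H) in
/-- The normalized Gram matrix `(1/m) k(x_j, x_l)`. -/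
noncomputable def gram {m : ℕ} (x : Fin m → X) : Matrix (Fin m) (Fin m) ℝ :=
  Matrix.of fun j l => (1 / (m : ℝ)) * (rep H (x l)) (x j)

/-- The matrix `φ(x)` whose `j`-th row is the feature vector of `x_j`; the feature map consists of
the elements of an orthonormal basis of `H`, evaluated at the given point. -/
noncomputable def featureMatrix {d m : ℕ} (b : OrthonormalBasis (Fin d) ℝ H) (x : Fin m → X) :
    Matrix (Fin m) (Fin d) ℝ :=
  Matrix.of fun j l => (b l) (x j)

/-- The local empirical risk. -/
noncomputable def empRisk {m : ℕ} (x : Fin m → X) (y : Fin m → ℝ) (f : H) : ℝ :=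
  (1 / (2 * (m : ℝ))) * ∑ j, (f (x j) - y j) ^ 2

/-- One step of local gradient descent with stepsize `η` (gradient in `H`). -/
noncomputable def gradStep (η : ℝ) {m : ℕ} (x : Fin m → X) (y : Fin m → ℝ) (f : H) : H :=
  f - η • gradient (empRisk (H := H) x y) f

/-- The local objective of FedProx at the current global model `g`. -/
noncomputable def proxObjective (η : ℝ) {m : ℕ} (x : Fin m → X) (y : Fin m → ℝ) (g f : H) : ℝ :=
  empRisk x y f + (1 / (2 * η)) * ‖f - g‖ ^ 2

/-- The model that a client returns when it receives the global model `g`. -/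
noncomputable def localUpdate (alg : Algorithm) (η : ℝ) {m : ℕ} (x : Fin m → X) (y : Fin m → ℝ)
    (g : H) : H :=
  match alg with
  | .fedAvg s => (gradStep η x y)^[s] g
  | .fedProx => argmin (proxObjective η x y g)

variable (H) in
/-- The operator `f ↦ (1/m) ∑ j, f(x_j) k_{x_j}`. -/
noncomputable def sampleOp {m : ℕ} (x : Fin m → X) : Module.End ℝ H where
  toFun f := (1 / (m : ℝ)) • ∑ j, f (x j) • rep H (x j)
  map_add' f g := by simp [add_smul, Finset.sum_add_distrib]
  map_smul' c f := by
    simp only [RKHS.coe_smul, Pi.smul_apply, smul_eq_mul, mul_smul, ← Finset.smul_sum,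
      RingHom.id_apply]
    rw [smul_comm]

variable (H) in
/-- The contribution of one client to the operator `L`: with `T` the sample operator,
`(1 - η T) ^ s` for FedAvg and `(1 + η T)⁻¹` for FedProx. -/
noncomputable def clientOp (alg : Algorithm) (η : ℝ) {m : ℕ} (x : Fin m → X) : Module.End ℝ H :=
  match alg with
  | .fedAvg s => (1 - η • sampleOp H x) ^ s
  | .fedProx => Ring.inverse (1 + η • sampleOp H x)

variable (H) in
/-- The `j`-th component of `Ψ_i`: with `T` the sample operator,
`(η/m) ∑_{τ<s} (1 - η T)^τ k_{x_j}` for FedAvg and `(η/m) (1 + η T)⁻¹ k_{x_j}` for FedProx. -/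
noncomputable def clientPsi (alg : Algorithm) (η : ℝ) {m : ℕ} (x : Fin m → X) (j : Fin m) : H :=
  match alg with
  | .fedAvg s => (η / m) • ∑ τ ∈ Finset.range s, ((1 - η • sampleOp H x) ^ τ) (rep H (x j))
  | .fedProx => (η / m) • (Ring.inverse (1 + η • sampleOp H x)) (rep H (x j))

/-! ### The whole system of `M` clients, client `i` having `n i` data points -/

/-- The weight `w_i = n_i / N`, where `N = ∑ i, n_i`. -/
noncomputable def weight {M : ℕ} (n : Fin M → ℕ) (i : Fin M) : ℝ :=
  (n i : ℝ) / ((∑ l, n l : ℕ) : ℝ)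

/-- The global model after `t` communication rounds, started from `f₀`. -/
noncomputable def globalModel (alg : Algorithm) (η : ℝ) {M : ℕ} {n : Fin M → ℕ}
    (x : (i : Fin M) → Fin (n i) → X) (y : (i : Fin M) → Fin (n i) → ℝ) (f₀ : H) : ℕ → H
  | 0 => f₀
  | t + 1 => ∑ i, weight n i • localUpdate alg η (x i) (y i) (globalModel alg η x y f₀ t)

variable (H) in
/-- The operator `L` that governs the dynamics of the global model. -/
noncomputable def globalOp (alg : Algorithm) (η : ℝ) {M : ℕ} {n : Fin M → ℕ}
    (x : (i : Fin M) → Fin (n i) → X) : Module.End ℝ H :=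
  ∑ i, weight n i • clientOp H alg η (x i)

variable (H) in
/-- The element `v · Ψ` of `H`, where `Ψ = (w_1 Ψ_1, …, w_M Ψ_M)`. -/
noncomputable def dotPsi (alg : Algorithm) (η : ℝ) {M : ℕ} {n : Fin M → ℕ}
    (x : (i : Fin M) → Fin (n i) → X) (v : (i : Fin M) → Fin (n i) → ℝ) : H :=
  ∑ i, weight n i • ∑ j, v i j • clientPsi H alg η (x i) j

/-- `f̄ = (1 - L)⁻¹ ((f_1^*(x_1), …, f_M^*(x_M)) · Ψ)`, meaningful when `1 - L` is invertible. -/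
noncomputable def fBar (alg : Algorithm) (η : ℝ) {M : ℕ} {n : Fin M → ℕ}
    (x : (i : Fin M) → Fin (n i) → X) (fStar : Fin M → H) : H :=
  (Ring.inverse (1 - globalOp H alg η x)) (dotPsi H alg η x fun i j => (fStar i) (x i j))

variable (H) in
/-- `γ = η max_i ‖K_{x_i}‖`. -/
noncomputable def gammaOf (η : ℝ) {M : ℕ} {n : Fin M → ℕ} (x : (i : Fin M) → Fin (n i) → X) : ℝ :=
  η * ⨆ i, specNorm (gram H (x i))

/-- The responses `y_ij = f_i^*(x_ij) + ξ_ij`. -/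
noncomputable def responses {M : ℕ} {n : Fin M → ℕ} (x : (i : Fin M) → Fin (n i) → X)
    (fStar : Fin M → H) (ξ : (Σ i : Fin M, Fin (n i)) → ℝ) : (i : Fin M) → Fin (n i) → ℝ :=
  fun i j => (fStar i) (x i j) + ξ ⟨i, j⟩

/-- The model heterogeneity `Γ = max_{i,j} ‖f_i^* - f_j^*‖`. -/
noncomputable def modelGap {M : ℕ} (fStar : Fin M → H) : ℝ :=
  ⨆ p : Fin M × Fin M, ‖fStar p.1 - fStar p.2‖

/-- The subspace model: `φ(x_i) = √(d / r_i) F_i U_iᵀ` almost surely, where `U_i` is a random `d × r_i`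
matrix with orthonormal columns, and the random subspaces spanned by the columns of the `U_i`, given
by their orthogonal projections `U_i U_iᵀ`, are independent with `E[U_i U_iᵀ] = (r_i / d) I`.
The coefficient matrices `F_i` may be deterministic or random. -/
structure IsSubspaceModel {Ω : Type*} [MeasurableSpace Ω] (μ : Measure Ω) {d M : ℕ}
    {n r : Fin M → ℕ} (b : OrthonormalBasis (Fin d) ℝ H) (x : Ω → (i : Fin M) → Fin (n i) → X)
    (U : (i : Fin M) → Ω → Matrix (Fin d) (Fin (r i)) ℝ)
    (F : (i : Fin M) → Ω → Matrix (Fin (n i)) (Fin (r i)) ℝ) : Prop where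
  measurable : ∀ i k l, Measurable fun ω => U i ω k l
  orthonormal : ∀ᵐ ω ∂μ, ∀ i, (U i ω).transpose * U i ω = 1
  factor : ∀ᵐ ω ∂μ, ∀ i, featureMatrix b (x ω i) =
    √((d : ℝ) / (r i : ℝ)) • (F i ω * (U i ω).transpose)
  indep : iIndepFun (fun i ω (p : Fin d × Fin d) => (U i ω * (U i ω).transpose) p.1 p.2) μ
  isotropic : ∀ i k l, ∫ ω, (U i ω * (U i ω).transpose) k l ∂μ =
    (((r i : ℝ) / (d : ℝ)) • (1 : Matrix (Fin d) (Fin d) ℝ)) k l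

end RKHS

/-- The conditioning assumption `λ_min(Fᵀ F / n) ≥ α` and `‖Fᵀ F / n‖ ≤ β` on an `n × r` matrix. -/
def IsConditioned (α β : ℝ) {n r : ℕ} (F : Matrix (Fin n) (Fin r) ℝ) : Prop :=
  α ≤ minEigenvalue ((1 / (n : ℝ)) • (F.transpose * F)) ∧
    specNorm ((1 / (n : ℝ)) • (F.transpose * F)) ≤ β

/-- The law `P` of the noise vector makes the coordinates independent, centred, and of variance at
most `σ²`. -/
structure IsNoiseLaw {ι : Type*} (σ : ℝ) (P : Measure (ι → ℝ)) : Prop where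
  indep : iIndepFun (fun (p : ι) (ξ : ι → ℝ) => ξ p) P
  memLp : ∀ p, MemLp (fun ξ : ι → ℝ => ξ p) 2 P
  mean : ∀ p, ∫ ξ, ξ p ∂P = 0
  var : ∀ p, variance (fun ξ : ι → ℝ => ξ p) P ≤ σ ^ 2

end FedLearn

namespace FedLearn

open Matrix
open scoped InnerProductSpace

/-! ### Trace inequalities for the matrix exponential. -/

section TraceExp

variable {n : Type*} [Fintype n] [DecidableEq n]

/-! The proof splits into a deterministic analysis for fixed covariates and a matrix Chernoff bound.
Write `T_i` for the sample operator of client `i`.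

Deterministic part. Both algorithms apply a spectral filter `A_i` of `T_i`: the client operator is
`1 - η T_i A_i`, with `s/κ ≤ A_i ≤ s` and `0 ≤ η T_i A_i ≤ 1` in the sense of `IsLocalFilter`.
Hence, if `∑ w_i T_i ≥ α/2`, the symmetric operator `L` satisfies `0 ≤ L ≤ 1 - ρ` with `ρ =
sηα/(2κ)`, and `1 - L` is invertible. Since `f̄` is the fixed point of the noiseless dynamics, `f_t
- f̄` equals `L^t (f_0 - f̄)` plus a combination of the noise variables (`globalModel_sub`). The
first term decays by `1 - ρ` per round. For the second, the covariance of the weighted `Ψ_ij` is at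
most `(ηs/N)(1 - L)`; this factor `1 - L` absorbs one of the two geometric sums of `L`, leaving
`(ηs/N) d/ρ = 2κd/(Nα)` (`contraction_bounds`). Heterogeneity is an energy estimate: `(1 - L)(f̄ -
f_j^*)` is the weighted sum of `η T_i A_i (f_i^* - f_j^*)`, and Cauchy-Schwarz for each positive
form `η T_i A_i` bounds the energy of `f̄ - f_j^*` by that of the differences `f_i^* - f_j^*`
(`norm_fBar_sub_sq_le`).

Probabilistic part. The factorization gives `∑ w_i T_i ≥ α S`, where `S = ∑ c_i P_i` has mean `1`,
`P_i = U_i U_iᵀ` are independent projections and `c_i = w_i d/r_i ≤ R = νd/N`. It remains to show `S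
≥ 1/2`. Let `m(t) = E tr exp(-tS)`. Comparing `P_i` with an independent copy through the trace
inequality `trace_sub_mul_exp_sub_exp_le` shows that `P_i` and `exp(-tS)` are almost uncorrelated
when `t c_i` is small (`integral_trace_exp_le`). Therefore `m' ≤ -(3/5) m` up to `t = 1/(2R)`, and
Markov's inequality bounds the failure probability by `d exp(-1/(20R))`, which is at most `1/d` once
`N ≥ 40 ν d log d`. -/

theorem continuous_matrix_exp : Continuous fun A : Matrix n n ℝ => NormedSpace.exp A := by
  let _ : NormedRing (Matrix n n ℝ) := Matrix.linftyOpNormedRing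
  let _ : NormedAlgebra ℝ (Matrix n n ℝ) := Matrix.linftyOpNormedAlgebra
  let _ : NormedAlgebra ℚ (Matrix n n ℝ) := NormedAlgebra.restrictScalars ℚ ℝ _
  exact NormedSpace.exp_continuous

theorem exp_conj_diagonal {U : Matrix n n ℝ} (hU : Uᵀ * U = 1) (a : n → ℝ) :
    NormedSpace.exp (U * diagonal a * Uᵀ) = U * diagonal (fun k => Real.exp (a k)) * Uᵀ := by
  have h1 : U * Uᵀ = 1 := mul_eq_one_comm.mp hU
  have hinv : U⁻¹ = Uᵀ := Matrix.inv_eq_left_inv hU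
  have hu : IsUnit U := ⟨⟨U, Uᵀ, h1, hU⟩, rfl⟩
  rw [← hinv, Matrix.exp_conj _ _ hu, Matrix.exp_diagonal]
  congr 3
  funext k
  rw [Pi.coe_exp, Real.exp_eq_exp_ℝ]

theorem exists_orthogonal_diagonal {A : Matrix n n ℝ} (hA : A.IsSymm) :
    ∃ (U : Matrix n n ℝ) (a : n → ℝ), Uᵀ * U = 1 ∧ A = U * diagonal a * Uᵀ := by
  have hH : A.IsHermitian := by
    rw [Matrix.IsHermitian, conjTranspose_eq_transpose_of_trivial]; exact hA
  refine ⟨hH.eigenvectorUnitary, hH.eigenvalues, ?_, ?_⟩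
  · have := Unitary.coe_star_mul_self hH.eigenvectorUnitary
    simpa [star_eq_conjTranspose] using this
  · have := hH.spectral_theorem
    conv_lhs => rw [this]
    simp [Unitary.conjStarAlgAut_apply, star_eq_conjTranspose]

/-- The squared entries of `Uᵀ V` act as nonnegative weights coupling the two spectra. They turn
traces of products into double sums, to which scalar inequalities apply term by term. -/
theorem trace_conj_diagonal_mul (U V : Matrix n n ℝ) (a b : n → ℝ) :
    trace (U * diagonal a * Uᵀ * (V * diagonal b * Vᵀ)) =
      ∑ k, ∑ l, a k * b l * (Uᵀ * V) k l ^ 2 := by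
  have : trace (U * diagonal a * Uᵀ * (V * diagonal b * Vᵀ)) =
      trace (diagonal a * ((Uᵀ * V) * diagonal b * (Uᵀ * V)ᵀ)) := by
    rw [Matrix.transpose_mul, transpose_transpose]
    simp only [Matrix.mul_assoc]
    rw [trace_mul_comm]
    simp only [Matrix.mul_assoc]
  rw [this]
  simp only [trace, diag_apply, diagonal_mul, Matrix.mul_apply (M := Uᵀ * V * diagonal b),
    mul_diagonal, transpose_apply, Finset.mul_sum]
  refine Finset.sum_congr rfl fun k _ => Finset.sum_congr rfl fun l _ => ?_
  ring

/-- This is `tanh (x/2) ≤ x/2` with denominators cleared; the difference of the sides is monotone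
because `1 - y ≤ exp (-y)`. -/
theorem two_sub_mul_exp_le {x : ℝ} (hx : 0 ≤ x) : (2 - x) * Real.exp x ≤ 2 + x := by
  have hd : ∀ y : ℝ, HasDerivAt (fun y => 2 + y - (2 - y) * Real.exp y)
      (1 - (1 - y) * Real.exp y) y := by
    intro y
    have h1 := ((hasDerivAt_id y).const_add 2).sub
      (((hasDerivAt_id y).const_sub 2).mul (Real.hasDerivAt_exp y))
    refine h1.congr_deriv ?_
    simp
    ring
  have hm : Monotone (fun y : ℝ => 2 + y - (2 - y) * Real.exp y) := by
    refine monotone_of_deriv_nonneg (fun y => (hd y).differentiableAt) fun y => ?_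
    rw [(hd y).deriv]
    have h2 : 1 - y ≤ Real.exp (-y) := by linarith [Real.add_one_le_exp (-y)]
    have h3 : Real.exp (-y) * Real.exp y = 1 := by rw [← Real.exp_add]; simp
    nlinarith [Real.exp_pos y]
  have := hm hx
  simp at this
  linarith

/-- The trapezoid rule overestimates the integral of the convex function `exp`: the mean of `exp`
between `b` and `a` is at most the mean of its endpoint values. -/
theorem sub_mul_exp_sub_exp_le (a b : ℝ) :
    (a - b) * (Real.exp a - Real.exp b) ≤ 1 / 2 * ((a - b) ^ 2 * (Real.exp a + Real.exp b)) := by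
  wlog h : b ≤ a generalizing a b
  · have := this b a (le_of_not_ge h)
    nlinarith
  have h1 := two_sub_mul_exp_le (sub_nonneg.mpr h)
  have h2 : Real.exp a = Real.exp (a - b) * Real.exp b := by rw [← Real.exp_add]; simp
  rw [h2]
  have h3 : Real.exp (a - b) - 1 ≤ 1 / 2 * ((a - b) * (Real.exp (a - b) + 1)) := by linarith
  have h4 := mul_le_mul_of_nonneg_left h3 (mul_nonneg (sub_nonneg.mpr h) (Real.exp_pos b).le)
  nlinarith [h4]

/-- By cyclicity every trace that occurs has the form `tr (f(A) g(B))`, hence is a double sum over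
the two spectra with the same nonnegative weights. The scalar inequality at each pair of eigenvalues
then suffices, although `A` and `B` need not commute. -/
theorem trace_sub_mul_exp_sub_exp_le {A B : Matrix n n ℝ} (hA : A.IsSymm) (hB : B.IsSymm) :
    trace ((A - B) * (NormedSpace.exp A - NormedSpace.exp B)) ≤
      1 / 2 * trace ((A - B) * (A - B) * (NormedSpace.exp A + NormedSpace.exp B)) := by
  obtain ⟨U, a, hU, rfl⟩ := exists_orthogonal_diagonal hA
  obtain ⟨V, b, hV, rfl⟩ := exists_orthogonal_diagonal hB
  rw [exp_conj_diagonal hU, exp_conj_diagonal hV]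
  have hU' : U * Uᵀ = 1 := mul_eq_one_comm.mp hU
  have hV' : V * Vᵀ = 1 := mul_eq_one_comm.mp hV
  have mulU : ∀ p q : n → ℝ, U * diagonal p * Uᵀ * (U * diagonal q * Uᵀ) =
      U * diagonal (fun k => p k * q k) * Uᵀ := by
    intro p q
    rw [← diagonal_mul_diagonal]
    simp only [Matrix.mul_assoc]
    rw [← Matrix.mul_assoc Uᵀ U, hU, Matrix.one_mul]
  have mulV : ∀ p q : n → ℝ, V * diagonal p * Vᵀ * (V * diagonal q * Vᵀ) =
      V * diagonal (fun k => p k * q k) * Vᵀ := by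
    intro p q
    rw [← diagonal_mul_diagonal]
    simp only [Matrix.mul_assoc]
    rw [← Matrix.mul_assoc Vᵀ V, hV, Matrix.one_mul]
  have oneU : U * diagonal (fun _ => (1 : ℝ)) * Uᵀ = 1 := by simp [hU']
  have oneV : V * diagonal (fun _ => (1 : ℝ)) * Vᵀ = 1 := by simp [hV']
  have trU : ∀ p : n → ℝ, trace (U * diagonal p * Uᵀ) =
      ∑ k, ∑ l, p k * 1 * (Uᵀ * V) k l ^ 2 := by
    intro p
    rw [← trace_conj_diagonal_mul, oneV, Matrix.mul_one]
  have trV : ∀ p : n → ℝ, trace (V * diagonal p * Vᵀ) =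
      ∑ k, ∑ l, 1 * p l * (Uᵀ * V) k l ^ 2 := by
    intro p
    rw [← trace_conj_diagonal_mul U V (fun _ => 1), oneU, Matrix.one_mul]
  have trVU : ∀ p q : n → ℝ, trace (V * diagonal p * Vᵀ * (U * diagonal q * Uᵀ)) =
      ∑ k, ∑ l, q k * p l * (Uᵀ * V) k l ^ 2 := by
    intro p q
    rw [trace_mul_comm, trace_conj_diagonal_mul]
  have trUVU : ∀ p q r : n → ℝ, trace (U * diagonal p * Uᵀ * (V * diagonal q * Vᵀ) *
      (U * diagonal r * Uᵀ)) = ∑ k, ∑ l, (r k * p k) * q l * (Uᵀ * V) k l ^ 2 := by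
    intro p q r
    rw [trace_mul_comm, ← Matrix.mul_assoc, mulU, trace_conj_diagonal_mul]
  have trVUV : ∀ p q r : n → ℝ, trace (V * diagonal p * Vᵀ * (U * diagonal q * Uᵀ) *
      (V * diagonal r * Vᵀ)) = ∑ k, ∑ l, q k * (r l * p l) * (Uᵀ * V) k l ^ 2 := by
    intro p q r
    rw [trace_mul_comm, ← Matrix.mul_assoc, mulV, trVU]
  simp only [sub_mul, mul_sub, mul_add, mulU, mulV, trace_sub, trace_add, trU, trV,
    trace_conj_diagonal_mul, trVU, trUVU, trVUV,
    Matrix.mul_assoc (V * diagonal b * Vᵀ) (U * diagonal a * Uᵀ) (U * diagonal _ * Uᵀ),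
    Matrix.mul_assoc (U * diagonal a * Uᵀ) (V * diagonal b * Vᵀ) (V * diagonal _ * Vᵀ)]
  simp only [← Finset.sum_sub_distrib, ← Finset.sum_add_distrib, Finset.mul_sum]
  refine Finset.sum_le_sum fun k _ => Finset.sum_le_sum fun l _ => ?_
  have := mul_le_mul_of_nonneg_right (sub_mul_exp_sub_exp_le (a k) (b l))
    (sq_nonneg ((Uᵀ * V) k l))
  nlinarith [this]

theorem trace_mul_exp_nonneg {P A : Matrix n n ℝ} (hP : P.IsSymm) (hPP : P * P = P)
    (hA : A.IsSymm) : 0 ≤ trace (P * NormedSpace.exp A) := by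
  obtain ⟨U, a, hU, rfl⟩ := exists_orthogonal_diagonal hA
  have h : trace (P * (U * diagonal (fun k => Real.exp (a k)) * Uᵀ)) =
      trace (diagonal (fun k => Real.exp (a k)) * ((P * U)ᵀ * (P * U))) := by
    rw [transpose_mul, hP.eq, Matrix.mul_assoc Uᵀ, ← Matrix.mul_assoc P P, hPP,
      Matrix.mul_assoc U, ← Matrix.mul_assoc P, trace_mul_comm, Matrix.mul_assoc]
  rw [exp_conj_diagonal hU, h]
  simp only [trace, diag_apply, diagonal_mul, mul_apply (M := (P * U)ᵀ), transpose_apply]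
  exact Finset.sum_nonneg fun k _ => mul_nonneg (Real.exp_pos _).le
    (Finset.sum_nonneg fun l _ => mul_self_nonneg _)

/-- A trace bound on the exponential gives a lower bound on the quadratic form. -/
theorem le_dotProduct_mulVec_of_trace_exp_lt {A : Matrix n n ℝ} (hA : A.IsSymm) {θ c : ℝ}
    (hθ : 0 < θ) (h : trace (NormedSpace.exp (-θ • A)) ≤ Real.exp (-θ * c)) (v : n → ℝ) :
    c * (v ⬝ᵥ v) ≤ v ⬝ᵥ (A *ᵥ v) := by
  obtain ⟨U, a, hU, rfl⟩ := exists_orthogonal_diagonal hA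
  have hU' : U * Uᵀ = 1 := mul_eq_one_comm.mp hU
  have e1 : -θ • (U * diagonal a * Uᵀ) = U * diagonal (fun k => -θ * a k) * Uᵀ := by
    have : diagonal (fun k => -θ * a k) = -θ • diagonal a := by
      ext i j; simp [diagonal_apply]
    rw [this]; simp
  rw [e1, exp_conj_diagonal hU, trace_mul_comm, ← Matrix.mul_assoc, hU, Matrix.one_mul,
    trace_diagonal] at h
  have hk : ∀ k, c ≤ a k := by
    intro k
    have h1 : Real.exp (-θ * a k) ≤ Real.exp (-θ * c) :=
      (Finset.single_le_sum (f := fun k => Real.exp (-θ * a k))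
        (fun i _ => (Real.exp_pos _).le) (Finset.mem_univ k)).trans h
    have h2 := Real.exp_le_exp.mp h1
    nlinarith
  have e2 : v ⬝ᵥ v = (Uᵀ *ᵥ v) ⬝ᵥ (Uᵀ *ᵥ v) := by
    rw [dotProduct_mulVec, vecMul_transpose, mulVec_mulVec, hU', one_mulVec]
  have e3 : v ⬝ᵥ ((U * diagonal a * Uᵀ) *ᵥ v) = (Uᵀ *ᵥ v) ⬝ᵥ (diagonal a *ᵥ (Uᵀ *ᵥ v)) := by
    rw [← mulVec_mulVec, ← mulVec_mulVec, dotProduct_mulVec, ← mulVec_transpose]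
  rw [e2, e3]
  simp only [dotProduct, mulVec_diagonal, Finset.mul_sum]
  refine Finset.sum_le_sum fun k _ => ?_
  nlinarith [hk k, mul_self_nonneg ((Uᵀ *ᵥ v) k)]

end TraceExp

/-! ### Integrability of continuous functions of bounded random variables. -/

section Bounded

variable {Ω : Type*} [MeasurableSpace Ω] {μ : Measure Ω}

theorem integrable_comp_of_mem_isCompact [IsFiniteMeasure μ] {E : Type*} [TopologicalSpace E]
    [MeasurableSpace E] [OpensMeasurableSpace E] {K : Set E} (hK : IsCompact K) {h : E → ℝ}
    (hh : Continuous h) {Z : Ω → E} (hZ : Measurable Z) (hZK : ∀ᵐ ω ∂μ, Z ω ∈ K) :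
    Integrable (fun ω => h (Z ω)) μ := by
  obtain ⟨B, hB⟩ := hK.exists_bound_of_continuousOn hh.continuousOn
  refine Integrable.of_bound (C := B) (hh.measurable.comp hZ).aestronglyMeasurable ?_
  filter_upwards [hZK] with ω hω using hB _ hω

end Bounded

/-! ### One random projection against the exponential of a perturbed matrix. -/

section RandomMatrix

variable {n : Type*}

local instance matrixMeasurableSpace : MeasurableSpace (Matrix n n ℝ) :=
  inferInstanceAs (MeasurableSpace (n → n → ℝ))

local instance matrixBorelSpace [Fintype n] : BorelSpace (Matrix n n ℝ) :=
  inferInstanceAs (BorelSpace (n → n → ℝ))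

local instance matrixSecondCountable [Fintype n] : SecondCountableTopology (Matrix n n ℝ) :=
  inferInstanceAs (SecondCountableTopology (n → n → ℝ))

theorem measurable_matrix_iff {Ω : Type*} [MeasurableSpace Ω] {P : Ω → Matrix n n ℝ} :
    Measurable P ↔ ∀ k l, Measurable fun ω => P ω k l :=
  ⟨fun h k l => (measurable_pi_apply l).comp ((measurable_pi_apply k).comp h),
    fun h => measurable_pi_lambda _ fun k => measurable_pi_lambda _ fun l => h k l⟩

/-- The matrices with entries in `[-B, B]`. -/
def matrixBox (n : Type*) (B : ℝ) : Set (Matrix n n ℝ) :=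
  {A | ∀ k l, A k l ∈ Set.Icc (-B) B}

theorem isCompact_matrixBox (B : ℝ) : IsCompact (matrixBox n B) := by
  have h : IsCompact (Set.pi Set.univ fun _ : n => Set.pi Set.univ fun _ : n => Set.Icc (-B) B) :=
    isCompact_univ_pi fun _ => isCompact_univ_pi fun _ => isCompact_Icc
  have e : matrixBox n B =
      Set.pi Set.univ fun _ : n => Set.pi Set.univ fun _ : n => Set.Icc (-B) B :=
    Set.ext fun A => ⟨fun hA k _ l _ => hA k l, fun hA k l => hA k trivial l trivial⟩
  exact e ▸ h

variable [Fintype n]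

theorem sum_sq_eq_of_projection {P : Matrix n n ℝ} (hP : P.IsSymm) (hPP : P * P = P) (k : n) :
    ∑ l, P k l ^ 2 = P k k := by
  conv_rhs => rw [← hPP]
  rw [mul_apply]
  exact Finset.sum_congr rfl fun l _ => by rw [hP.apply k l, sq]

theorem mem_matrixBox_of_projection {P : Matrix n n ℝ} (hP : P.IsSymm) (hPP : P * P = P) :
    P ∈ matrixBox n 1 := by
  intro k l
  have h1 : ∀ k l, P k l ^ 2 ≤ P k k := fun k l => by
    rw [← sum_sq_eq_of_projection hP hPP k]
    exact Finset.single_le_sum (f := fun l => P k l ^ 2) (fun _ _ => sq_nonneg _)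
      (Finset.mem_univ l)
  have h2 : P k k ≤ 1 := by nlinarith [h1 k k]
  exact abs_le.mp (abs_le_of_sq_le_sq (by linarith [h1 k l]) zero_le_one)

variable {Ω : Type*} [MeasurableSpace Ω] {μ : Measure Ω}

/-- The entrywise expectation of a random matrix. -/
noncomputable def meanMatrix (μ : Measure Ω) (A : Ω → Matrix n n ℝ) : Matrix n n ℝ :=
  Matrix.of fun k l => ∫ ω, A ω k l ∂μ

/-- The trace of a product is bilinear in the entries, so the expectation over two independent
copies factors into entrywise means. -/
theorem integral_trace_mul_prod [IsProbabilityMeasure μ] {A B : Ω → Matrix n n ℝ}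
    (hA : ∀ k l, Integrable (fun ω => A ω k l) μ) (hB : ∀ k l, Integrable (fun ω => B ω k l) μ) :
    Integrable (fun z : Ω × Ω => trace (A z.1 * B z.2)) (μ.prod μ) ∧
    ∫ z : Ω × Ω, trace (A z.1 * B z.2) ∂(μ.prod μ) = trace (meanMatrix μ A * meanMatrix μ B) := by
  simp only [trace, diag_apply, mul_apply]
  have h : ∀ k l, Integrable (fun z : Ω × Ω => A z.1 k l * B z.2 l k) (μ.prod μ) :=
    fun k l => (hA k l).mul_prod (hB l k)
  refine ⟨integrable_finsetSum _ fun k _ => integrable_finsetSum _ fun l _ => h k l, ?_⟩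
  rw [integral_finsetSum _ fun k _ => integrable_finsetSum _ fun l _ => h k l]
  refine Finset.sum_congr rfl fun k _ => ?_
  rw [integral_finsetSum _ fun l _ => h k l]
  refine Finset.sum_congr rfl fun l _ => ?_
  rw [integral_prod_mul (fun ω => A ω k l) (fun ω => B ω l k)]
  rfl

theorem trace_meanMatrix {A : Ω → Matrix n n ℝ} (hA : ∀ k l, Integrable (fun ω => A ω k l) μ) :
    trace (meanMatrix μ A) = ∫ ω, trace (A ω) ∂μ := by
  simp only [trace, diag_apply]
  rw [integral_finsetSum _ fun k _ => hA k k]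
  rfl

variable [DecidableEq n]

/-- For a random projection `P` with mean `p I`, the exponential of `Y - t P` is nearly
uncorrelated with `P`. -/
theorem integral_trace_exp_le [IsProbabilityMeasure μ] {P : Ω → Matrix n n ℝ}
    (hPm : Measurable P) (hP : ∀ᵐ ω ∂μ, (P ω).IsSymm ∧ P ω * P ω = P ω) {p : ℝ}
    (hp : 0 ≤ p) (hmean : meanMatrix μ P = p • 1) {Y : Matrix n n ℝ} (hY : Y.IsSymm) {t : ℝ}
    (ht : 0 < t) :
    (1 - t / 2) * p * ∫ ω, trace (NormedSpace.exp (Y - t • P ω)) ∂μ ≤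
      (1 + t / 2) * ∫ ω, trace (P ω * NormedSpace.exp (Y - t • P ω)) ∂μ := by
  set G : Ω → Matrix n n ℝ := fun ω => NormedSpace.exp (Y - t • P ω) with hG
  have hbox : ∀ᵐ ω ∂μ, P ω ∈ matrixBox n 1 :=
    hP.mono fun ω h => mem_matrixBox_of_projection h.1 h.2
  have hexp : Continuous fun A : Matrix n n ℝ => NormedSpace.exp (Y - t • A) :=
    continuous_matrix_exp.comp (by fun_prop)
  have hint : ∀ h : Matrix n n ℝ → Matrix n n ℝ, Continuous h → ∀ k l,
      Integrable (fun ω => h (P ω) k l) μ := fun h hh k l =>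
    integrable_comp_of_mem_isCompact (isCompact_matrixBox 1)
      (h := fun A => h A k l) (by fun_prop) hPm hbox
  have iP := hint (fun A => A) continuous_id
  have iG := hint _ hexp
  -- The constant factor `1` lets terms involving only one of the two copies be written as the trace
  -- of a product across copies, so that `integral_trace_mul_prod` evaluates all of them.
  have i1 := hint (fun _ => 1) continuous_const
  have iPG := hint (fun A => A * NormedSpace.exp (Y - t • A)) (continuous_id.mul hexp)
  have iGP := hint (fun A => NormedSpace.exp (Y - t • A) * A) (hexp.mul continuous_id)
  have m1 : meanMatrix μ (fun _ : Ω => (1 : Matrix n n ℝ)) = 1 := by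
    ext k l; simp [meanMatrix]
  set D := ∫ ω, trace (P ω * G ω) ∂μ with hD
  set m := ∫ ω, trace (G ω) ∂μ with hm
  have tPG : trace (meanMatrix μ fun ω => P ω * G ω) = D := trace_meanMatrix iPG
  have tGP : trace (meanMatrix μ fun ω => G ω * P ω) = D := by
    rw [trace_meanMatrix iGP]
    exact integral_congr_ae (.of_forall fun ω => trace_mul_comm _ _)
  have tG : trace (meanMatrix μ G) = m := trace_meanMatrix iG
  have hD0 : 0 ≤ D := integral_nonneg_of_ae (hP.mono fun ω h =>
    trace_mul_exp_nonneg h.1 h.2 (hY.sub (h.1.smul t)))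
  -- the pointwise inequality
  have hpt : ∀ᵐ z ∂(μ.prod μ),
      trace (P z.1 * G z.2) + trace (G z.1 * P z.2)
        - trace (P z.1 * G z.1 * 1) - trace (1 * (P z.2 * G z.2)) ≤
      t / 2 * (trace (P z.1 * G z.1 * 1) + trace (G z.1 * P z.2) + trace (P z.1 * G z.2)
        + trace (1 * (P z.2 * G z.2)) - trace (G z.1 * P z.1 * P z.2)
        - trace (P z.1 * G z.1 * P z.2) - trace (P z.1 * (P z.2 * G z.2))
        - trace (P z.1 * (G z.2 * P z.2))) := by
    have h1 : ∀ᵐ z ∂(μ.prod μ), (P z.1).IsSymm ∧ P z.1 * P z.1 = P z.1 :=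
      Measure.quasiMeasurePreserving_fst.ae hP
    have h2 : ∀ᵐ z ∂(μ.prod μ), (P z.2).IsSymm ∧ P z.2 * P z.2 = P z.2 :=
      Measure.quasiMeasurePreserving_snd.ae hP
    filter_upwards [h1, h2] with z ⟨s1, q1⟩ ⟨s2, q2⟩
    -- The two matrices differ only by `-t (P - P')`, with `P'` an independent copy; for projections
    -- `(P - P')² = P + P' - PP' - P'P`.
    have key := trace_sub_mul_exp_sub_exp_le (hY.sub (s1.smul t)) (hY.sub (s2.smul t))
    change trace (_ * (G z.1 - G z.2)) ≤ 1 / 2 * trace (_ * (G z.1 + G z.2)) at key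
    generalize P z.1 = P₁ at *
    generalize P z.2 = P₂ at *
    generalize G z.1 = G₁ at *
    generalize G z.2 = G₂ at *
    have e : Y - t • P₁ - (Y - t • P₂) = (-t) • (P₁ - P₂) := by
      rw [neg_smul, smul_sub]; abel
    rw [e] at key
    have e2 : (P₁ - P₂) * (P₁ - P₂) = P₁ + P₂ - P₁ * P₂ - P₂ * P₁ := by
      rw [sub_mul, mul_sub, mul_sub, q1, q2]; abel
    rw [smul_mul_assoc, smul_mul_smul_comm, smul_mul_assoc, e2, trace_smul, trace_smul,
      smul_eq_mul, smul_eq_mul] at key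
    simp only [sub_mul, add_mul, mul_sub, mul_add, trace_sub, trace_add] at key
    have c1 : trace (P₂ * G₁) = trace (G₁ * P₂) := trace_mul_comm _ _
    have c2 : trace (P₁ * P₂ * G₁) = trace (G₁ * P₁ * P₂) := by
      rw [trace_mul_comm, Matrix.mul_assoc]
    have c3 : trace (P₂ * P₁ * G₁) = trace (P₁ * G₁ * P₂) := by
      rw [Matrix.mul_assoc, trace_mul_comm]
    have c4 : trace (P₂ * P₁ * G₂) = trace (P₁ * (G₂ * P₂)) := by
      rw [Matrix.mul_assoc, trace_mul_comm, Matrix.mul_assoc]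
    have c5 : trace (P₁ * P₂ * G₂) = trace (P₁ * (P₂ * G₂)) := by rw [Matrix.mul_assoc]
    rw [c1, c2, c3, c4, c5] at key
    rw [Matrix.mul_one, Matrix.one_mul]
    refine le_of_mul_le_mul_left ?_ ht
    linarith
  -- integrate it
  have J1 := integral_trace_mul_prod iP iG
  have J2 := integral_trace_mul_prod iG iP
  have J3 := integral_trace_mul_prod iPG i1
  have J4 := integral_trace_mul_prod i1 iPG
  have J5 := integral_trace_mul_prod iGP iP
  have J6 := integral_trace_mul_prod iPG iP
  have J7 := integral_trace_mul_prod iP iPG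
  have J8 := integral_trace_mul_prod iP iGP
  have hpint := integral_mono_ae (((J1.1.add J2.1).sub J3.1).sub J4.1)
    ((((((((J3.1.add J2.1).add J1.1).add J4.1).sub J5.1).sub J6.1).sub J7.1).sub J8.1).const_mul
      (t / 2)) hpt
  simp only [Pi.add_apply, Pi.sub_apply] at hpint
  rw [integral_const_mul] at hpint
  erw [integral_sub ((J1.1.add J2.1).sub J3.1) J4.1, integral_sub (J1.1.add J2.1) J3.1,
    integral_add J1.1 J2.1,
    integral_sub (((((((J3.1.add J2.1).add J1.1).add J4.1).sub J5.1).sub J6.1).sub J7.1)) J8.1,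
    integral_sub ((((((J3.1.add J2.1).add J1.1).add J4.1).sub J5.1).sub J6.1)) J7.1,
    integral_sub (((((J3.1.add J2.1).add J1.1).add J4.1).sub J5.1)) J6.1,
    integral_sub ((((J3.1.add J2.1).add J1.1).add J4.1)) J5.1,
    integral_add ((J3.1.add J2.1).add J1.1) J4.1,
    integral_add (J3.1.add J2.1) J1.1,
    integral_add J3.1 J2.1] at hpint
  rw [J1.2, J2.2, J3.2, J4.2, J5.2, J6.2, J7.2, J8.2] at hpint
  rw [m1, hmean] at hpint
  simp only [mul_one, one_mul, smul_mul_assoc, mul_smul_comm, trace_smul, smul_eq_mul] at hpint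
  rw [tG, tPG, tGP] at hpint
  -- Integration gives `2pm - 2D ≤ (t/2)(2D + 2pm - 4pD)`; the term `-4pD` is nonpositive and is
  -- dropped.
  nlinarith [mul_nonneg (mul_nonneg ht.le hp) hD0]

end RandomMatrix

/-! ### Matrix Chernoff lower tail for sums of independent projections. -/

section Chernoff

theorem isSymm_sum_smul {n ι : Type*} {c : ι → ℝ} {P : ι → Matrix n n ℝ} (hP : ∀ i, (P i).IsSymm)
    (s : Finset ι) : (∑ i ∈ s, c i • P i).IsSymm := by
  simp [Matrix.IsSymm, transpose_sum, (hP _).eq]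

theorem sum_smul_mem_matrixBox {n ι : Type*} {c : ι → ℝ} (hc : ∀ i, 0 ≤ c i) {P : ι → Matrix n n ℝ}
    (hP : ∀ i, P i ∈ matrixBox n 1) (s : Finset ι) :
    ∑ i ∈ s, c i • P i ∈ matrixBox n (∑ i ∈ s, c i) := by
  intro k l
  rw [Matrix.sum_apply]
  simp only [Matrix.smul_apply, smul_eq_mul, ← Finset.sum_neg_distrib, Set.mem_Icc]
  exact ⟨Finset.sum_le_sum fun i _ => by nlinarith [hc i, (hP i k l).1],
    Finset.sum_le_sum fun i _ => by nlinarith [hc i, (hP i k l).2]⟩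

variable {n : Type*} [Fintype n]

attribute [local instance] matrixMeasurableSpace matrixBorelSpace matrixSecondCountable

variable {Ω : Type*} [MeasurableSpace Ω] {μ : Measure Ω} [IsProbabilityMeasure μ]

theorem integral_comp_prodMk_of_indepFun {E E' : Type*} [MeasurableSpace E] [MeasurableSpace E']
    {X : Ω → E} {Z : Ω → E'} (hX : Measurable X) (hZ : Measurable Z) (hXZ : IndepFun X Z μ)
    {h : E × E' → ℝ} (hh : Measurable h) (hint : Integrable (fun ω => h (X ω, Z ω)) μ) :
    Integrable (fun ω' => ∫ ω, h (X ω, Z ω') ∂μ) μ ∧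
    ∫ ω, h (X ω, Z ω) ∂μ = ∫ ω', ∫ ω, h (X ω, Z ω') ∂μ ∂μ := by
  have hmap : μ.map (fun ω => (X ω, Z ω)) = (μ.prod μ).map (Prod.map X Z) := by
    rw [hXZ.map_prod_eq_prod_map_map hX.aemeasurable hZ.aemeasurable,
      Measure.map_prod_map _ _ hX hZ]
  have hXZm : Measurable fun ω => (X ω, Z ω) := hX.prodMk hZ
  have hpm : Measurable (Prod.map X Z) := hX.prodMap hZ
  have hint' : Integrable (fun z : Ω × Ω => h (Prod.map X Z z)) (μ.prod μ) := by
    have h1 : Integrable h (μ.map fun ω => (X ω, Z ω)) :=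
      (integrable_map_measure hh.aestronglyMeasurable hXZm.aemeasurable).mpr hint
    rw [hmap] at h1
    exact (integrable_map_measure hh.aestronglyMeasurable hpm.aemeasurable).mp h1
  refine ⟨hint'.integral_prod_right, ?_⟩
  rw [← integral_map hXZm.aemeasurable hh.aestronglyMeasurable, hmap,
    integral_map hpm.aemeasurable hh.aestronglyMeasurable, integral_prod_symm _ hint']
  rfl

variable [DecidableEq n] {ι : Type*} [Fintype ι]

theorem continuous_trace_mul_exp (t : ℝ) :
    Continuous fun z : Matrix n n ℝ × Matrix n n ℝ =>
      trace (z.1 * NormedSpace.exp (-t • z.2)) := by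
  have : Continuous fun z : Matrix n n ℝ × Matrix n n ℝ => NormedSpace.exp (-t • z.2) :=
    continuous_matrix_exp.comp (by fun_prop)
  fun_prop

theorem hasDerivAt_trace_exp {A : Matrix n n ℝ} (hA : A.IsSymm) (t : ℝ) :
    HasDerivAt (fun t : ℝ => trace (NormedSpace.exp (-t • A)))
      (-trace (A * NormedSpace.exp (-t • A))) t := by
  obtain ⟨U, a, hU, rfl⟩ := exists_orthogonal_diagonal hA
  have e1 : ∀ t : ℝ, NormedSpace.exp (-t • (U * diagonal a * Uᵀ)) =
      U * diagonal (fun k => Real.exp (-t * a k)) * Uᵀ := by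
    intro t
    rw [← exp_conj_diagonal hU]
    have : diagonal (fun k => -t * a k) = -t • diagonal a := by
      ext i j; simp [diagonal_apply]
    rw [this]; simp
  have e2 : ∀ b : n → ℝ, trace (U * diagonal b * Uᵀ) = ∑ k, b k := by
    intro b
    rw [trace_mul_comm, ← Matrix.mul_assoc, hU, Matrix.one_mul, trace_diagonal]
  have e3 : U * diagonal a * Uᵀ * (U * diagonal (fun k => Real.exp (-t * a k)) * Uᵀ) =
      U * diagonal (fun k => a k * Real.exp (-t * a k)) * Uᵀ := by
    rw [← diagonal_mul_diagonal]
    simp only [Matrix.mul_assoc]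
    rw [← Matrix.mul_assoc Uᵀ U, hU, Matrix.one_mul]
  simp only [e1, e2, e3]
  rw [← Finset.sum_neg_distrib]
  refine HasDerivAt.fun_sum fun k _ => ?_
  have := (((hasDerivAt_id t).neg.mul_const (a k))).exp
  refine this.congr_deriv ?_
  simp
  ring

theorem hasDerivAt_integral_trace_exp {S : Ω → Matrix n n ℝ} (hSm : Measurable S)
    (hS : ∀ᵐ ω ∂μ, (S ω).IsSymm) {B : ℝ} (hB : ∀ᵐ ω ∂μ, S ω ∈ matrixBox n B) (t : ℝ) :
    HasDerivAt (fun t : ℝ => ∫ ω, trace (NormedSpace.exp (-t • S ω)) ∂μ)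
      (-∫ ω, trace (S ω * NormedSpace.exp (-t • S ω)) ∂μ) t := by
  have hc : Continuous fun z : ℝ × Matrix n n ℝ =>
      trace (z.2 * NormedSpace.exp (-z.1 • z.2)) := by
    have : Continuous fun z : ℝ × Matrix n n ℝ => NormedSpace.exp (-z.1 • z.2) :=
      continuous_matrix_exp.comp (by fun_prop)
    fun_prop
  have hc0 : ∀ t : ℝ, Continuous fun A : Matrix n n ℝ => trace (NormedSpace.exp (-t • A)) := by
    intro t
    have : Continuous fun z : Matrix n n ℝ => NormedSpace.exp (-t • z) :=
      continuous_matrix_exp.comp (by fun_prop)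
    fun_prop
  -- Times within `1` of `t` and matrices in the box form a compact set, so the derivative has a
  -- constant dominating bound.
  obtain ⟨K, hK⟩ := ((isCompact_Icc (a := t - 1) (b := t + 1)).prod
    (isCompact_matrixBox (n := n) B)).exists_bound_of_continuousOn hc.continuousOn
  have := hasDerivAt_integral_of_dominated_loc_of_deriv_le (μ := μ) (x₀ := t)
    (F := fun t ω => trace (NormedSpace.exp (-t • S ω)))
    (F' := fun t ω => -trace (S ω * NormedSpace.exp (-t • S ω)))
    (bound := fun _ => K) (s := Set.Icc (t - 1) (t + 1))
    (Icc_mem_nhds (by linarith) (by linarith))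
    (.of_forall fun x => ((hc0 x).measurable.comp hSm).aestronglyMeasurable)
    (integrable_comp_of_mem_isCompact (isCompact_matrixBox B) (hc0 t) hSm hB)
    (((hc.comp (by fun_prop : Continuous fun A => (t, A))).measurable.comp
      hSm).neg.aestronglyMeasurable)
    (hB.mono fun ω hω x hx => by
      rw [norm_neg]; exact hK (x, S ω) ⟨hx, hω⟩)
    (integrable_const _)
    (hS.mono fun ω hω x _ => hasDerivAt_trace_exp hω x)
  rw [← integral_neg]
  exact this.2

/-- By independence the other projections can be frozen: `integral_trace_exp_le` applies with `Y`
the frozen part of the exponent and step `θ c_i`, and Fubini averages the result. -/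
theorem integral_trace_proj_mul_exp_ge {P : ι → Ω → Matrix n n ℝ} (hPm : ∀ i, Measurable (P i))
    (hP : ∀ᵐ ω ∂μ, ∀ i, (P i ω).IsSymm ∧ P i ω * P i ω = P i ω) (hind : iIndepFun P μ)
    {p c : ι → ℝ} (hp : ∀ i, 0 ≤ p i) (hc : ∀ i, 0 < c i)
    (hmean : ∀ i, meanMatrix μ (P i) = p i • 1) {θ : ℝ} (hθ : 0 < θ) (i : ι) :
    (1 - θ * c i / 2) * p i * ∫ ω, trace (NormedSpace.exp (-θ • ∑ j, c j • P j ω)) ∂μ ≤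
      (1 + θ * c i / 2) *
        ∫ ω, trace (P i ω * NormedSpace.exp (-θ • ∑ j, c j • P j ω)) ∂μ := by
  classical
  set Z : Ω → Matrix n n ℝ := fun ω => ∑ j ∈ Finset.univ.erase i, c j • P j ω with hZ
  have hZm : Measurable Z := by
    refine Finset.measurable_fun_sum _ fun j _ => ?_
    exact (continuous_const_smul (c j)).measurable.comp (hPm j)
  have hPZ : IndepFun (P i) Z μ := by
    have h1 : iIndepFun (fun j ω => c j • P j ω) μ :=
      hind.comp (fun j A => c j • A) fun j => (continuous_const_smul (c j)).measurable
    have h2 := (h1.indepFun_finsetSum_of_notMem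
      (fun j => (continuous_const_smul (c j)).measurable.comp (hPm j))
      (Finset.notMem_erase i Finset.univ)).symm
    -- Independence is available for the scaled matrices `c_i P_i`; since `c_i ≠ 0`, rescaling
    -- recovers `P_i` itself.
    have h3 := h2.comp (φ := fun A => (c i)⁻¹ • A) (ψ := id)
      (continuous_const_smul _).measurable measurable_id
    convert! h3 using 1
    · funext ω
      simp [smul_smul, inv_mul_cancel₀ (hc i).ne']
    · funext ω
      simp [hZ]
  have hsum : ∀ ω, -θ • ∑ j, c j • P j ω = -θ • Z ω - (θ * c i) • P i ω := by
    intro ω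
    rw [← Finset.add_sum_erase _ _ (Finset.mem_univ i), smul_add, smul_smul, neg_mul, neg_smul]
    abel
  simp only [hsum]
  have hbox : ∀ᵐ ω ∂μ, (P i ω, Z ω) ∈
      matrixBox n 1 ×ˢ matrixBox n (∑ j ∈ Finset.univ.erase i, c j) := by
    filter_upwards [hP] with ω hω
    exact ⟨mem_matrixBox_of_projection (hω i).1 (hω i).2,
      sum_smul_mem_matrixBox (fun j => (hc j).le)
        (fun j => mem_matrixBox_of_projection (hω j).1 (hω j).2) _⟩
  have hcomp := (isCompact_matrixBox (n := n) 1).prod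
    (isCompact_matrixBox (n := n) (∑ j ∈ Finset.univ.erase i, c j))
  have hexp : Continuous fun z : Matrix n n ℝ × Matrix n n ℝ =>
      NormedSpace.exp (-θ • z.2 - (θ * c i) • z.1) :=
    continuous_matrix_exp.comp (by fun_prop)
  have c1 : Continuous fun z : Matrix n n ℝ × Matrix n n ℝ =>
      trace (NormedSpace.exp (-θ • z.2 - (θ * c i) • z.1)) := by fun_prop
  have c2 : Continuous fun z : Matrix n n ℝ × Matrix n n ℝ =>
      trace (z.1 * NormedSpace.exp (-θ • z.2 - (θ * c i) • z.1)) := by fun_prop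
  have hm := (hPm i).prodMk hZm
  obtain ⟨j1, e1⟩ := integral_comp_prodMk_of_indepFun (hPm i) hZm hPZ c1.measurable
    (integrable_comp_of_mem_isCompact hcomp c1 hm hbox)
  obtain ⟨j2, e2⟩ := integral_comp_prodMk_of_indepFun (hPm i) hZm hPZ c2.measurable
    (integrable_comp_of_mem_isCompact hcomp c2 hm hbox)
  dsimp only at e1 e2 j1 j2
  rw [e1, e2, ← integral_const_mul, ← integral_const_mul]
  refine integral_mono_ae (j1.const_mul _) (j2.const_mul _) ?_
  filter_upwards [hP] with ω hω
  exact integral_trace_exp_le (hPm i) (hP.mono fun ω h => h i) (hp i) (hmean i)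
    ((isSymm_sum_smul (fun j => (hω j).1) _).smul (-θ)) (mul_pos hθ (hc i))

theorem integral_trace_sum_mul_exp {P : ι → Ω → Matrix n n ℝ} (hPm : ∀ i, Measurable (P i))
    (hP : ∀ᵐ ω ∂μ, ∀ i, (P i ω).IsSymm ∧ P i ω * P i ω = P i ω) (c : ι → ℝ)
    (hc : ∀ i, 0 ≤ c i) (t : ℝ) :
    ∫ ω, trace ((∑ j, c j • P j ω) * NormedSpace.exp (-t • ∑ j, c j • P j ω)) ∂μ =
      ∑ i, c i * ∫ ω, trace (P i ω * NormedSpace.exp (-t • ∑ j, c j • P j ω)) ∂μ := by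
  have hSm : Measurable fun ω => ∑ j, c j • P j ω := Finset.measurable_fun_sum _ fun j _ =>
    (continuous_const_smul (c j)).measurable.comp (hPm j)
  have hint : ∀ i, Integrable
      (fun ω => trace (P i ω * NormedSpace.exp (-t • ∑ j, c j • P j ω))) μ := by
    intro i
    have hK := (isCompact_matrixBox (n := n) 1).prod (isCompact_matrixBox (n := n) (∑ j, c j))
    have hmem : ∀ᵐ ω ∂μ, (P i ω, ∑ j, c j • P j ω) ∈
        matrixBox n 1 ×ˢ matrixBox n (∑ j, c j) := by
      filter_upwards [hP] with ω h
      exact Set.mk_mem_prod (mem_matrixBox_of_projection (h i).1 (h i).2)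
        (sum_smul_mem_matrixBox hc
          (fun j => mem_matrixBox_of_projection (h j).1 (h j).2) Finset.univ)
    have hZ : Measurable fun ω => (P i ω, ∑ j, c j • P j ω) := (hPm i).prodMk hSm
    have h := integrable_comp_of_mem_isCompact hK (continuous_trace_mul_exp t) hZ hmem
    exact h
  simp only [← integral_const_mul]
  rw [← integral_finsetSum _ fun i _ => (hint i).const_mul (c i)]
  refine integral_congr_ae (.of_forall fun ω => ?_)
  simp only [Finset.sum_mul, trace_sum, smul_mul_assoc, trace_smul, smul_eq_mul]

/-- A Grönwall argument: weighting the estimates for the individual projections by `c_i` and using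
`∑ c_i p_i = 1` gives `-m' ≥ (3/5) m`, so `m(t) exp(3t/5)` decreases from its value at `0`, the
matrix size. -/
theorem integral_trace_exp_sum_le {P : ι → Ω → Matrix n n ℝ} (hPm : ∀ i, Measurable (P i))
    (hP : ∀ᵐ ω ∂μ, ∀ i, (P i ω).IsSymm ∧ P i ω * P i ω = P i ω) (hind : iIndepFun P μ)
    {p c : ι → ℝ} (hp : ∀ i, 0 ≤ p i) (hc : ∀ i, 0 < c i)
    (hmean : ∀ i, meanMatrix μ (P i) = p i • 1) (hsum : ∑ i, c i * p i = 1) {R : ℝ} (hR : 0 < R)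
    (hcR : ∀ i, c i ≤ R) :
    ∫ ω, trace (NormedSpace.exp (-(1 / (2 * R)) • ∑ j, c j • P j ω)) ∂μ ≤
      Fintype.card n * Real.exp (-(3 / 5 * (1 / (2 * R)))) := by
  set S : Ω → Matrix n n ℝ := fun ω => ∑ j, c j • P j ω with hS
  have hSm : Measurable S := Finset.measurable_fun_sum _ fun j _ =>
    (continuous_const_smul (c j)).measurable.comp (hPm j)
  have hSsymm : ∀ᵐ ω ∂μ, (S ω).IsSymm := hP.mono fun ω h => isSymm_sum_smul (fun j => (h j).1) _
  have hbox : ∀ᵐ ω ∂μ, S ω ∈ matrixBox n (∑ j, c j) := hP.mono fun ω h =>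
    sum_smul_mem_matrixBox (fun j => (hc j).le)
      (fun j => mem_matrixBox_of_projection (h j).1 (h j).2) _
  set m : ℝ → ℝ := fun t => ∫ ω, trace (NormedSpace.exp (-t • S ω)) ∂μ with hm
  have hder : ∀ t, HasDerivAt m (-∫ ω, trace (S ω * NormedSpace.exp (-t • S ω)) ∂μ) t :=
    hasDerivAt_integral_trace_exp hSm hSsymm hbox
  have hm0 : ∀ t, 0 ≤ m t := fun t => integral_nonneg_of_ae (hSsymm.mono fun ω h => by
    have := trace_mul_exp_nonneg (P := 1) isSymm_one (Matrix.one_mul 1) (h.smul (-t))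
    rwa [Matrix.one_mul] at this)
  have hineq : ∀ t, 0 < t → t < 1 / (2 * R) →
      3 / 5 * m t ≤ ∫ ω, trace (S ω * NormedSpace.exp (-t • S ω)) ∂μ := by
    intro t ht htR
    have hexpand := integral_trace_sum_mul_exp hPm hP c fun i => (hc i).le
    have htR' : t * R < 1 / 2 := by
      rw [lt_div_iff₀ (by positivity)] at htR; linarith
    change _ ≤ ∫ ω, trace ((∑ j, c j • P j ω) * NormedSpace.exp (-t • ∑ j, c j • P j ω)) ∂μ
    rw [hexpand t, ← one_mul (m t), ← hsum, Finset.sum_mul, Finset.mul_sum]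
    refine Finset.sum_le_sum fun i _ => ?_
    have h1 := integral_trace_proj_mul_exp_ge hPm hP hind hp hc hmean ht i
    change _ * m t ≤ _ * (∫ ω, trace (P i ω * NormedSpace.exp (-t • S ω)) ∂μ) at h1
    have h2 : t * c i ≤ 1 / 2 :=
      (mul_le_mul_of_nonneg_left (hcR i) ht.le).trans htR'.le
    have h3 : 0 < t * c i := mul_pos ht (hc i)
    set D := ∫ ω, trace (P i ω * NormedSpace.exp (-t • S ω)) ∂μ
    -- As `t c_i ≤ 1/2`, the factors `1 ∓ t c_i/2` are at least `3/4` and at most `5/4`; their ratio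
    -- is the rate `3/5`.
    have h4 : 3 / 4 * (p i * m t) ≤ 5 / 4 * D := by
      have hpm := mul_nonneg (hp i) (hm0 t)
      have hD : 0 ≤ D := by
        by_contra hD
        have : 0 ≤ (1 + t * c i / 2) * D := le_trans (by
          rw [mul_assoc]; exact mul_nonneg (by linarith) hpm) h1
        nlinarith
      nlinarith
    nlinarith [hc i]
  have hanti : AntitoneOn (fun t => m t * Real.exp (3 / 5 * t)) (Set.Icc 0 (1 / (2 * R))) := by
    have hd : ∀ t, HasDerivAt (fun t => m t * Real.exp (3 / 5 * t))
        ((-∫ ω, trace (S ω * NormedSpace.exp (-t • S ω)) ∂μ) * Real.exp (3 / 5 * t) +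
          m t * (Real.exp (3 / 5 * t) * (3 / 5))) t := fun t =>
      (hder t).mul (((hasDerivAt_id t).const_mul (3 / 5)).exp.congr_deriv (by simp))
    refine antitoneOn_of_deriv_nonpos (convex_Icc _ _)
      (fun t _ => (hd t).continuousAt.continuousWithinAt)
      (fun t _ => (hd t).differentiableAt.differentiableWithinAt) fun t ht => ?_
    rw [interior_Icc] at ht
    rw [(hd t).deriv]
    nlinarith [hineq t ht.1 ht.2, Real.exp_pos (3 / 5 * t)]
  have hR2 : 0 ≤ 1 / (2 * R) := by positivity
  have h := hanti (Set.left_mem_Icc.mpr hR2) (Set.right_mem_Icc.mpr hR2) hR2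
  have hm00 : m 0 = Fintype.card n := by simp [hm, NormedSpace.exp_zero]
  simp only [mul_zero, Real.exp_zero, mul_one, hm00] at h
  rw [Real.exp_neg, ← div_eq_mul_inv, le_div_iff₀ (Real.exp_pos _)]
  exact h

/-- Lower tail of a weighted sum of independent random projections. -/
theorem exists_measurableSet_half_le_sum_projections {P : ι → Ω → Matrix n n ℝ}
    (hPm : ∀ i, Measurable (P i))
    (hP : ∀ᵐ ω ∂μ, ∀ i, (P i ω).IsSymm ∧ P i ω * P i ω = P i ω) (hind : iIndepFun P μ)
    {p c : ι → ℝ} (hp : ∀ i, 0 ≤ p i) (hc : ∀ i, 0 < c i)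
    (hmean : ∀ i, meanMatrix μ (P i) = p i • 1) (hsum : ∑ i, c i * p i = 1) {R : ℝ} (hR : 0 < R)
    (hcR : ∀ i, c i ≤ R) :
    ∃ E : Set Ω, MeasurableSet E ∧
      1 - Fintype.card n * Real.exp (-(1 / (20 * R))) ≤ μ.real E ∧
      ∀ᵐ ω ∂μ, ω ∈ E → ∀ v : n → ℝ,
        1 / 2 * (v ⬝ᵥ v) ≤ ∑ i, c i * (v ⬝ᵥ (P i ω *ᵥ v)) := by
  set S : Ω → Matrix n n ℝ := fun ω => ∑ j, c j • P j ω with hS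
  have hSm : Measurable S := Finset.measurable_fun_sum _ fun j _ =>
    (continuous_const_smul (c j)).measurable.comp (hPm j)
  have hSsymm : ∀ᵐ ω ∂μ, (S ω).IsSymm := hP.mono fun ω h => isSymm_sum_smul (fun j => (h j).1) _
  have hbox : ∀ᵐ ω ∂μ, S ω ∈ matrixBox n (∑ j, c j) := hP.mono fun ω h =>
    sum_smul_mem_matrixBox (fun j => (hc j).le)
      (fun j => mem_matrixBox_of_projection (h j).1 (h j).2) _
  set θ := 1 / (2 * R) with hθ
  have hθ0 : 0 < θ := by positivity
  have hcont : Continuous fun A : Matrix n n ℝ => trace (NormedSpace.exp (-θ • A)) := by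
    have : Continuous fun z : Matrix n n ℝ => NormedSpace.exp (-θ • z) :=
      continuous_matrix_exp.comp (by fun_prop)
    fun_prop
  set g : Ω → ℝ := fun ω => trace (NormedSpace.exp (-θ • S ω)) with hg
  have hgm : Measurable g := hcont.measurable.comp hSm
  have hgi : Integrable g μ :=
    integrable_comp_of_mem_isCompact (isCompact_matrixBox _) hcont hSm hbox
  have hg0 : 0 ≤ᵐ[μ] g := hSsymm.mono fun ω h => by
    have := trace_mul_exp_nonneg (P := 1) isSymm_one (Matrix.one_mul 1) (h.smul (-θ))
    rwa [Matrix.one_mul] at this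
  have hE : MeasurableSet {ω | Real.exp (-θ * (1 / 2)) ≤ g ω} :=
    measurableSet_le measurable_const hgm
  refine ⟨{ω | Real.exp (-θ * (1 / 2)) ≤ g ω}ᶜ, hE.compl, ?_, ?_⟩
  · have h1 := mul_meas_ge_le_integral_of_nonneg hg0 hgi (Real.exp (-θ * (1 / 2)))
    have h2 := h1.trans (integral_trace_exp_sum_le hPm hP hind hp hc hmean hsum hR hcR)
    rw [probReal_compl_eq_one_sub hE]
    -- The rate `3/5` exceeds the threshold `1/2` by `1/10`, and `θ/10 = 1/(20R)`.
    have h3 : Real.exp (-(3 / 5 * θ)) =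
        Real.exp (-θ * (1 / 2)) * Real.exp (-(1 / (20 * R))) := by
      rw [← Real.exp_add, hθ]; congr 1; field_simp; norm_num
    rw [← hθ, h3, mul_left_comm] at h2
    have := le_of_mul_le_mul_left h2 (Real.exp_pos _)
    linarith
  · filter_upwards [hSsymm] with ω hω hmem v
    have h1 := le_dotProduct_mulVec_of_trace_exp_lt hω hθ0 (not_le.mp fun h => hmem h).le v
    rw [hS] at h1
    simpa only [sum_mulVec, dotProduct_sum, smul_mulVec, dotProduct_smul, smul_eq_mul] using h1

end Chernoff

/-! ### Spectral filters and powers of symmetric operators. -/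

section Operators

variable {H : Type*} [NormedAddCommGroup H] [InnerProductSpace ℝ H]

theorem inner_apply_of_diagonal {ι : Type*} [Fintype ι] (e : OrthonormalBasis ι ℝ H)
    {D : Module.End ℝ H} {a : ι → ℝ} (hD : ∀ k, D (e k) = a k • e k) (f g : H) :
    ⟪D f, g⟫_ℝ = ∑ k, a k * (⟪e k, f⟫_ℝ * ⟪e k, g⟫_ℝ) := by
  conv_lhs => rw [← e.sum_repr' f]
  simp only [map_sum, map_smul, hD, sum_inner, inner_smul_left, RCLike.conj_to_real]
  exact Finset.sum_congr rfl fun k _ => by ring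

theorem norm_sq_eq_sum_inner_sq {ι : Type*} [Fintype ι] (e : OrthonormalBasis ι ℝ H) (f : H) :
    ‖f‖ ^ 2 = ∑ k, ⟪e k, f⟫_ℝ ^ 2 := by
  rw [← e.sum_sq_norm_inner_right f]
  simp

theorem isUnit_of_coercive [FiniteDimensional ℝ H] {D : Module.End ℝ H} {c : ℝ} (hc : 0 < c)
    (hD : ∀ f, c * ‖f‖ ^ 2 ≤ ⟪D f, f⟫_ℝ) : IsUnit D := by
  rw [LinearMap.isUnit_iff_ker_eq_bot, LinearMap.ker_eq_bot']
  intro f hf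
  have h := hD f
  rw [hf, inner_zero_left] at h
  have : ‖f‖ ^ 2 ≤ 0 := by nlinarith [sq_nonneg ‖f‖]
  exact norm_eq_zero.mp (pow_eq_zero_iff two_ne_zero |>.mp (le_antisymm this (sq_nonneg _)))

theorem pow_apply_of_eigen {D : Module.End ℝ H} {a : ℝ} {f : H} (h : D f = a • f) (t : ℕ) :
    (D ^ t) f = a ^ t • f := by
  induction t with
  | zero => simp
  | succ t ih => rw [pow_succ', Module.End.mul_apply, ih, map_smul, h, smul_smul, pow_succ]

/-- `A` is a spectral filter for the positive operator `T`, with the two-sided bound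
`s / κ ≤ A ≤ s`, and `0 ≤ η T A ≤ 1`. -/
structure IsLocalFilter (η s κ : ℝ) (T A : Module.End ℝ H) : Prop where
  comm : A * T = T * A
  symm : A.IsSymmetric
  upper : ∀ f, η * ⟪T (A f), f⟫_ℝ ≤ s * (η * ⟪T f, f⟫_ℝ)
  lower : ∀ f, s / κ * (η * ⟪T f, f⟫_ℝ) ≤ η * ⟪T (A f), f⟫_ℝ
  le_one : ∀ f, η * ⟪T (A f), f⟫_ℝ ≤ ‖f‖ ^ 2
  sq_upper : ∀ f, η * ⟪T (A f), A f⟫_ℝ ≤ s * (η * ⟪T (A f), f⟫_ℝ)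

/-- `T` and `A` are diagonal in the same basis, so each property reduces to an inequality between
eigenvalues. -/
theorem isLocalFilter_of_eigenbasis {ι : Type*} [Fintype ι] (e : OrthonormalBasis ι ℝ H)
    {η s κ : ℝ} (hη : 0 ≤ η) {T A : Module.End ℝ H} {l a : ι → ℝ}
    (hT : ∀ k, T (e k) = l k • e k) (hA : ∀ k, A (e k) = a k • e k) (hl : ∀ k, 0 ≤ l k)
    (ha : ∀ k, 0 ≤ a k) (has : ∀ k, a k ≤ s) (hκ : ∀ k, s / κ ≤ a k)
    (h1 : ∀ k, η * l k * a k ≤ 1) : IsLocalFilter η s κ T A := by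
  have hTA : ∀ k, (T * A) (e k) = (l k * a k) • e k := fun k => by
    rw [Module.End.mul_apply, hA, map_smul, hT, smul_smul, mul_comm]
  have iTA : ∀ f g, ⟪T (A f), g⟫_ℝ = _ := inner_apply_of_diagonal e hTA
  have iT := inner_apply_of_diagonal e hT
  have iA := inner_apply_of_diagonal e hA
  have ieA : ∀ k f, ⟪e k, A f⟫_ℝ = a k * ⟪e k, f⟫_ℝ := by
    intro k f
    rw [real_inner_comm, iA, Finset.sum_eq_single k]
    · simp
    · intro j _ hj
      rw [e.inner_eq_zero hj]; simp
    · simp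
  refine ⟨?_, ?_, fun f => ?_, fun f => ?_, fun f => ?_, fun f => ?_⟩
  · refine e.toBasis.ext fun k => ?_
    rw [e.coe_toBasis, Module.End.mul_apply, Module.End.mul_apply, hT, hA, map_smul, map_smul, hT,
      hA, smul_comm]
  · intro f g
    rw [iA, real_inner_comm, iA]
    exact Finset.sum_congr rfl fun k _ => by ring
  · rw [iTA, iT]
    simp only [Finset.mul_sum]
    refine Finset.sum_le_sum fun k _ => ?_
    have := mul_le_mul_of_nonneg_right (has k)
      (mul_nonneg (mul_nonneg hη (hl k)) (mul_self_nonneg ⟪e k, f⟫_ℝ))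
    linarith
  · rw [iTA, iT]
    simp only [Finset.mul_sum]
    refine Finset.sum_le_sum fun k _ => ?_
    have := mul_le_mul_of_nonneg_right (hκ k)
      (mul_nonneg (mul_nonneg hη (hl k)) (mul_self_nonneg ⟪e k, f⟫_ℝ))
    linarith
  · rw [iTA, norm_sq_eq_sum_inner_sq e]
    simp only [Finset.mul_sum]
    refine Finset.sum_le_sum fun k _ => ?_
    have := mul_le_mul_of_nonneg_right (h1 k) (mul_self_nonneg ⟪e k, f⟫_ℝ)
    linarith
  · rw [iTA, iTA]
    simp only [Finset.mul_sum, ieA]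
    refine Finset.sum_le_sum fun k _ => ?_
    have := mul_le_mul_of_nonneg_right (has k) (mul_nonneg (mul_nonneg (mul_nonneg hη (hl k))
      (ha k)) (mul_self_nonneg ⟪e k, f⟫_ℝ))
    linarith

theorem exists_eigenbasis [FiniteDimensional ℝ H] {D : Module.End ℝ H} (hD : D.IsSymmetric) :
    ∃ (e : OrthonormalBasis (Fin (Module.finrank ℝ H)) ℝ H)
      (l : Fin (Module.finrank ℝ H) → ℝ), (∀ k, D (e k) = l k • e k) ∧
        ∀ k, l k = ⟪D (e k), e k⟫_ℝ := by
  refine ⟨hD.eigenvectorBasis rfl, hD.eigenvalues rfl, fun k => ?_, fun k => ?_⟩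
  · simp
  · rw [hD.apply_eigenvectorBasis rfl k]
    simp [inner_smul_left]

/-- `κ` is chosen so that `s/κ` is the geometric sum at `x = γ`, and the sum only grows when `x`
drops below `γ`. -/
theorem geom_sum_ge_of_kappa {γ x : ℝ} (hγ : 0 < γ) (hγ1 : γ < 1) (hxγ : x ≤ γ)
    {s : ℕ} :
    (s : ℝ) / Algorithm.kappa γ (.fedAvg s) ≤ ∑ τ ∈ Finset.range s, (1 - x) ^ τ := by
  rcases Nat.eq_zero_or_pos s with rfl | hs
  · simp
  have h1 : γ * ∑ τ ∈ Finset.range s, (1 - γ) ^ τ = 1 - (1 - γ) ^ s := by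
    have := mul_neg_geom_sum (1 - γ) s
    simpa using this
  have hs' : (s : ℝ) ≠ 0 := by positivity
  have h2 : (s : ℝ) / Algorithm.kappa γ (.fedAvg s) = ∑ τ ∈ Finset.range s, (1 - γ) ^ τ := by
    rw [Algorithm.kappa, ← h1]
    by_cases h0 : ∑ τ ∈ Finset.range s, (1 - γ) ^ τ = 0
    · rw [h0]; simp
    · field_simp
  rw [h2]
  exact Finset.sum_le_sum fun τ _ => pow_le_pow_left₀ (by linarith) (by linarith) τ

theorem kappa_pos {γ : ℝ} (hγ : 0 < γ) (alg : Algorithm) (hs : 1 ≤ alg.localSteps)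
    (h : alg ≠ .fedProx → γ < 1) : 0 < alg.kappa γ := by
  cases alg with
  | fedAvg s =>
    have hγ1 := h (by simp)
    have hs : 1 ≤ s := hs
    have : (1 - γ) ^ s < 1 := pow_lt_one₀ (by linarith) (by linarith) (by omega)
    have hs' : (0 : ℝ) < s := by exact_mod_cast hs
    exact div_pos (mul_pos hγ hs') (by linarith)
  | fedProx => simp only [Algorithm.kappa]; linarith

theorem isLocalFilter_fedAvg [FiniteDimensional ℝ H] {T : Module.End ℝ H} (hT : T.IsSymmetric)
    (hT0 : ∀ f, 0 ≤ ⟪T f, f⟫_ℝ) {η γ : ℝ} (hη : 0 < η) (hγ : 0 < γ) (hγ1 : γ < 1)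
    (hTγ : ∀ f, η * ⟪T f, f⟫_ℝ ≤ γ * ‖f‖ ^ 2) (s : ℕ) :
    IsLocalFilter η s (Algorithm.kappa γ (.fedAvg s)) T
      (∑ τ ∈ Finset.range s, (1 - η • T) ^ τ) := by
  obtain ⟨e, l, he, hl⟩ := exists_eigenbasis hT
  have hl0 : ∀ k, 0 ≤ l k := fun k => hl k ▸ hT0 _
  have hlγ : ∀ k, η * l k ≤ γ := fun k => by simpa [← hl] using hTγ (e k)
  have hq : ∀ k, 0 ≤ η * l k := fun k => mul_nonneg hη.le (hl0 k)
  have hY : ∀ k, (1 - η • T) (e k) = (1 - η * l k) • e k := fun k => by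
    rw [LinearMap.sub_apply, LinearMap.smul_apply, he, Module.End.one_apply, sub_smul, one_smul,
      smul_smul]
  refine isLocalFilter_of_eigenbasis e hη.le he
    (a := fun k => ∑ τ ∈ Finset.range s, (1 - η * l k) ^ τ) (fun k => ?_) hl0 (fun k => ?_)
    (fun k => ?_) (fun k => geom_sum_ge_of_kappa hγ hγ1 (hlγ k)) (fun k => ?_)
  · simp only [LinearMap.sum_apply, pow_apply_of_eigen (hY k), Finset.sum_smul]
  · exact Finset.sum_nonneg fun τ _ => pow_nonneg (by linarith [hlγ k]) τ
  · refine (Finset.sum_le_sum fun τ _ =>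
      pow_le_one₀ (n := τ) (by linarith [hlγ k]) (by linarith [hq k])).trans ?_
    simp
  -- The geometric sum telescopes: `η l a = 1 - (1 - η l)^s`.
  · have := mul_neg_geom_sum (1 - η * l k) s
    rw [sub_sub_cancel] at this
    rw [this]
    linarith [pow_nonneg (by linarith [hlγ k] : 0 ≤ 1 - η * l k) s]

theorem isUnit_one_add_smul [FiniteDimensional ℝ H] {T : Module.End ℝ H}
    (hT0 : ∀ f, 0 ≤ ⟪T f, f⟫_ℝ) {η : ℝ} (hη : 0 < η) : IsUnit (1 + η • T) := by
  refine isUnit_of_coercive one_pos fun f => ?_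
  rw [LinearMap.add_apply, inner_add_left, LinearMap.smul_apply, inner_smul_left,
    Module.End.one_apply, real_inner_self_eq_norm_sq]
  have := mul_nonneg hη.le (hT0 f)
  simp only [RCLike.conj_to_real]
  linarith

theorem isLocalFilter_fedProx [FiniteDimensional ℝ H] {T : Module.End ℝ H} (hT : T.IsSymmetric)
    (hT0 : ∀ f, 0 ≤ ⟪T f, f⟫_ℝ) {η γ : ℝ} (hη : 0 < η)
    (hTγ : ∀ f, η * ⟪T f, f⟫_ℝ ≤ γ * ‖f‖ ^ 2) :
    IsLocalFilter η 1 (Algorithm.kappa γ .fedProx) T (Ring.inverse (1 + η • T)) := by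
  obtain ⟨e, l, he, hl⟩ := exists_eigenbasis hT
  have hl0 : ∀ k, 0 ≤ l k := fun k => hl k ▸ hT0 _
  have hlγ : ∀ k, η * l k ≤ γ := fun k => by simpa [← hl] using hTγ (e k)
  have hq : ∀ k, 0 ≤ η * l k := fun k => mul_nonneg hη.le (hl0 k)
  have hu := isUnit_one_add_smul hT0 hη
  have hY : ∀ k, (1 + η • T) (e k) = (1 + η * l k) • e k := fun k => by
    rw [LinearMap.add_apply, LinearMap.smul_apply, he, Module.End.one_apply, add_smul, one_smul,
      smul_smul]
  have hpos : ∀ k, 0 < 1 + η * l k := fun k => by linarith [hq k]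
  refine isLocalFilter_of_eigenbasis e hη.le he
    (a := fun k => (1 + η * l k)⁻¹) (fun k => ?_) hl0 (fun k => ?_)
    (fun k => ?_) (fun k => ?_) (fun k => ?_)
  · have h : (Ring.inverse (1 + η • T) * (1 + η • T)) (e k) = e k := by
      rw [Ring.inverse_mul_cancel _ hu]; rfl
    rw [Module.End.mul_apply, hY, map_smul] at h
    rw [eq_inv_smul_iff₀ (hpos k).ne', h]
  · exact (inv_pos.mpr (hpos k)).le
  · exact inv_le_one_of_one_le₀ (by linarith [hq k])
  · rw [Algorithm.kappa, one_div]
    exact inv_anti₀ (hpos k) (by linarith [hlγ k])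
  · rw [← div_eq_mul_inv, div_le_one (hpos k)]
    linarith

/-- Decay of the powers of a positive operator below `1 - ρ`, and the total weight that its
geometric sums give to vectors whose covariance is controlled by `1 - L`. -/
theorem contraction_bounds [FiniteDimensional ℝ H] {L : Module.End ℝ H} (hL : L.IsSymmetric)
    (hL0 : ∀ f, 0 ≤ ⟪L f, f⟫_ℝ) {ρ : ℝ} (hρ : 0 < ρ)
    (hLρ : ∀ f, ρ * ‖f‖ ^ 2 ≤ ⟪(1 - L) f, f⟫_ℝ) (t : ℕ) :
    (∀ f, ‖(L ^ t) f‖ ^ 2 ≤ (1 - ρ) ^ (2 * t) * ‖f‖ ^ 2) ∧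
    ∀ {ι : Type*} [Fintype ι] (ψ : ι → H) (c : ℝ), 0 ≤ c →
      (∀ f, ∑ p, ⟪ψ p, f⟫_ℝ ^ 2 ≤ c * ⟪(1 - L) f, f⟫_ℝ) →
      ∑ p, ‖∑ τ ∈ Finset.range t, (L ^ τ) (ψ p)‖ ^ 2 ≤ c * (Module.finrank ℝ H / ρ) := by
  obtain ⟨e, l, he, hl⟩ := exists_eigenbasis hL
  have hl0 : ∀ k, 0 ≤ l k := fun k => hl k ▸ hL0 _
  have hl1 : ∀ k, ⟪(1 - L) (e k), e k⟫_ℝ = 1 - l k := fun k => by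
    rw [LinearMap.sub_apply, inner_sub_left, ← hl]; simp
  have hlρ : ∀ k, l k ≤ 1 - ρ := fun k => by
    have := hLρ (e k)
    rw [hl1] at this
    simp at this
    linarith
  have hpow : ∀ τ k f, ⟪e k, (L ^ τ) f⟫_ℝ = l k ^ τ * ⟪e k, f⟫_ℝ := by
    intro τ k f
    rw [real_inner_comm, inner_apply_of_diagonal e (fun k => pow_apply_of_eigen (he k) τ),
      Finset.sum_eq_single k]
    · simp
    · intro j _ hj
      rw [e.inner_eq_zero hj]; simp
    · simp
  refine ⟨fun f => ?_, fun ψ c hc hψ => ?_⟩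
  · rw [norm_sq_eq_sum_inner_sq e, norm_sq_eq_sum_inner_sq e, Finset.mul_sum]
    refine Finset.sum_le_sum fun k _ => ?_
    rw [hpow, mul_pow, ← pow_mul, mul_comm t]
    exact mul_le_mul_of_nonneg_right (pow_le_pow_left₀ (hl0 k) (hlρ k) _) (sq_nonneg _)
  · simp only [norm_sq_eq_sum_inner_sq e, inner_sum, hpow, ← Finset.sum_mul, mul_pow]
    rw [Finset.sum_comm]
    simp only [← Finset.mul_sum]
    have hk : ∀ k, (∑ τ ∈ Finset.range t, l k ^ τ) ^ 2 * ∑ p, ⟪e k, ψ p⟫_ℝ ^ 2 ≤ c * (1 / ρ) := by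
      intro k
      have h1 := hψ (e k)
      rw [hl1] at h1
      simp only [real_inner_comm (e k)] at h1
      set v := ∑ τ ∈ Finset.range t, l k ^ τ
      have hv0 : 0 ≤ v := Finset.sum_nonneg fun τ _ => pow_nonneg (hl0 k) τ
      have hv : (1 - l k) * v ≤ 1 := by
        rw [mul_neg_geom_sum]; linarith [pow_nonneg (hl0 k) t]
      have hvρ : v ≤ 1 / ρ := by
        rw [le_div_iff₀ hρ]
        nlinarith [hlρ k]
      -- One factor `v` is cancelled by `1 - l`, so only one power of `1/ρ` is paid per
      -- eigendirection.
      calc v ^ 2 * ∑ p, ⟪e k, ψ p⟫_ℝ ^ 2 ≤ v ^ 2 * (c * (1 - l k)) :=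
            mul_le_mul_of_nonneg_left h1 (sq_nonneg v)
        _ = c * (v * ((1 - l k) * v)) := by ring
        _ ≤ c * (v * 1) := by gcongr
        _ ≤ c * (1 / ρ) := by rw [mul_one]; gcongr
    refine (Finset.sum_le_sum fun k _ => hk k).trans ?_
    simp
    exact le_of_eq (by ring)

end Operators

/-! ### The local update of a single client. -/

section Client

variable {X H : Type*} [NormedAddCommGroup H] [InnerProductSpace ℝ H] [CompleteSpace H]
  [RKHS ℝ H X ℝ]

theorem inner_rep_left (x : X) (f : H) : ⟪rep H x, f⟫_ℝ = f x := by
  rw [rep, RKHS.kerFun_inner]; simp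

theorem coe_sum_apply {ι : Type*} (s : Finset ι) (f : ι → H) (x : X) :
    (∑ i ∈ s, f i) x = ∑ i ∈ s, f i x := by
  rw [← inner_rep_left, inner_sum]
  simp only [inner_rep_left]

variable {m : ℕ} (x : Fin m → X) (y : Fin m → ℝ)

theorem sampleOp_apply (f : H) :
    sampleOp H x f = (1 / (m : ℝ)) • ∑ j, f (x j) • rep H (x j) := rfl

theorem inner_sampleOp (f g : H) :
    ⟪sampleOp H x f, g⟫_ℝ = (1 / (m : ℝ)) * ∑ j, f (x j) * g (x j) := by
  simp [sampleOp_apply, inner_smul_left, sum_inner, inner_rep_left]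

theorem sampleOp_isSymmetric : (sampleOp H x).IsSymmetric := fun f g => by
  rw [inner_sampleOp, real_inner_comm, inner_sampleOp]
  simp only [mul_comm]

theorem inner_sampleOp_self_nonneg (f : H) : 0 ≤ ⟪sampleOp H x f, f⟫_ℝ := by
  rw [inner_sampleOp]
  exact mul_nonneg (by positivity) (Finset.sum_nonneg fun j _ => mul_self_nonneg _)

theorem inner_mulVec_le_specNorm {k : ℕ} (A : Matrix (Fin k) (Fin k) ℝ) (v : Fin k → ℝ) :
    v ⬝ᵥ (A.mulVec v) ≤ specNorm A * (v ⬝ᵥ v) := by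
  have h1 : v ⬝ᵥ (A.mulVec v) =
      ⟪WithLp.toLp 2 v, Matrix.toEuclideanCLM (n := Fin k) (𝕜 := ℝ) A (WithLp.toLp 2 v)⟫_ℝ := by
    simp [EuclideanSpace.inner_eq_star_dotProduct, dotProduct_comm]
  have h2 : v ⬝ᵥ v = ‖WithLp.toLp 2 v‖ ^ 2 := by
    rw [EuclideanSpace.real_norm_sq_eq]
    simp [dotProduct, pow_two]
  rw [h1, h2, specNorm]
  calc _ ≤ ‖WithLp.toLp 2 v‖ * ‖Matrix.toEuclideanCLM (n := Fin k) (𝕜 := ℝ) A (WithLp.toLp 2 v)‖ :=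
        real_inner_le_norm _ _
    _ ≤ ‖WithLp.toLp 2 v‖ * (‖Matrix.toEuclideanCLM (n := Fin k) (𝕜 := ℝ) A‖ *
          ‖WithLp.toLp 2 v‖) := by
        gcongr
        exact ContinuousLinearMap.le_opNorm _ _
    _ = _ := by ring

/-- The sample operator inherits the norm bound of the Gram matrix: with `a` the vector of values of
`f`, `‖T f‖²` is the normalized quadratic form of the Gram matrix at `a`, hence at most its norm
times `⟪T f, f⟫`. Cauchy-Schwarz finishes. -/
theorem inner_sampleOp_self_le (f : H) :
    ⟪sampleOp H x f, f⟫_ℝ ≤ specNorm (gram H x) * ‖f‖ ^ 2 := by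
  set T := sampleOp H x
  set a : Fin m → ℝ := fun j => f (x j)
  have h1 : ⟪T f, f⟫_ℝ = (1 / (m : ℝ)) * (a ⬝ᵥ a) := inner_sampleOp x f f
  have h2 : ‖T f‖ ^ 2 = (1 / (m : ℝ)) * (a ⬝ᵥ ((gram H x).mulVec a)) := by
    rw [← real_inner_self_eq_norm_sq]
    conv_lhs => rw [inner_sampleOp, sampleOp_apply]
    congr 1
    refine Finset.sum_congr rfl fun j _ => ?_
    rw [RKHS.coe_smul, Pi.smul_apply, coe_sum_apply, smul_eq_mul, Matrix.mulVec, dotProduct,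
      Finset.mul_sum]
    congr 1
    refine Finset.sum_congr rfl fun l _ => ?_
    simp only [gram, Matrix.of_apply, RKHS.coe_smul, Pi.smul_apply, smul_eq_mul]
    ring
  have h3 : ‖T f‖ ^ 2 ≤ specNorm (gram H x) * ⟪T f, f⟫_ℝ := by
    rw [h2, h1, mul_left_comm]
    exact mul_le_mul_of_nonneg_left (inner_mulVec_le_specNorm _ _) (by positivity)
  have h4 : ⟪T f, f⟫_ℝ ≤ ‖T f‖ * ‖f‖ := real_inner_le_norm _ _
  have hs : 0 ≤ specNorm (gram H x) := norm_nonneg _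
  have h5 : ‖T f‖ ≤ specNorm (gram H x) * ‖f‖ := by
    rcases (norm_nonneg (T f)).eq_or_lt' with h | h
    · rw [h]; positivity
    · refine le_of_mul_le_mul_left ?_ h
      nlinarith [mul_le_mul_of_nonneg_left h4 hs]
  nlinarith [norm_nonneg f]

theorem gradStep_eq (η : ℝ) (g : H) :
    gradStep η x y g = (1 - η • sampleOp H x) g + (η / m) • ∑ j, y j • rep H (x j) := by
  have hgrad : HasGradientAt (empRisk (H := H) x y)
      (sampleOp H x g - (1 / (m : ℝ)) • ∑ j, y j • rep H (x j)) g := by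
    rw [hasGradientAt_iff_hasFDerivAt]
    have h1 : ∀ j, HasFDerivAt (fun f : H => f (x j)) (innerSL ℝ (rep H (x j))) g := by
      intro j
      have : (fun f : H => f (x j)) = innerSL ℝ (rep H (x j)) :=
        funext fun f => (inner_rep_left (x j) f).symm
      rw [this]
      exact ContinuousLinearMap.hasFDerivAt _
    have h2 : HasFDerivAt (empRisk (H := H) x y) _ g :=
      (HasFDerivAt.fun_sum (u := Finset.univ) fun j _ =>
        ((h1 j).sub_const (y j)).pow 2).const_mul (1 / (2 * (m : ℝ)))
    refine h2.congr_fderiv ?_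
    ext f
    simp [inner_sampleOp, inner_rep_left, Finset.mul_sum, ← Finset.sum_sub_distrib]
    refine Finset.sum_congr rfl fun j _ => ?_
    ring
  rw [gradStep, hgrad.gradient, LinearMap.sub_apply, LinearMap.smul_apply, Module.End.one_apply,
    smul_sub, smul_smul, mul_one_div]
  abel

theorem iterate_affine {E : Type*} [AddCommGroup E] [Module ℝ E] {S : E → E} {Y : Module.End ℝ E}
    {u : E} (hS : ∀ g, S g = Y g + u) (s : ℕ) (g : E) :
    S^[s] g = (Y ^ s) g + (∑ τ ∈ Finset.range s, Y ^ τ) u := by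
  induction s with
  | zero => simp
  | succ s ih =>
    rw [Function.iterate_succ_apply', ih, hS, map_add, Finset.sum_range_succ', pow_succ',
      LinearMap.add_apply, pow_zero, Module.End.one_apply, Module.End.mul_apply,
      ← Module.End.mul_apply Y (∑ τ ∈ _, _), Finset.mul_sum]
    simp only [pow_succ']
    abel

/-- At a solution of the normal equation the linear term in `h` vanishes, so the expansion is exact
with a positive definite remainder. This yields both existence and uniqueness of the minimizer. -/
theorem proxObjective_add (η : ℝ) (hη : η ≠ 0) (g f h : H)
    (hf : (1 + η • sampleOp H x) f = g + (η / m) • ∑ j, y j • rep H (x j)) :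
    proxObjective η x y g (f + h) = proxObjective η x y g f +
      ((1 / (2 * (m : ℝ))) * ∑ j, h (x j) ^ 2 + (1 / (2 * η)) * ‖h‖ ^ 2) := by
  have h1 : ⟪(1 + η • sampleOp H x) f, h⟫_ℝ =
      ⟪g + (η / m) • ∑ j, y j • rep H (x j), h⟫_ℝ := by rw [hf]
  simp only [LinearMap.add_apply, LinearMap.smul_apply, Module.End.one_apply, inner_add_left,
    inner_smul_left, inner_sampleOp, sum_inner, inner_rep_left, RCLike.conj_to_real] at h1
  have h2 : ‖f + h - g‖ ^ 2 = ‖f - g‖ ^ 2 + 2 * (⟪f, h⟫_ℝ - ⟪g, h⟫_ℝ) + ‖h‖ ^ 2 := by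
    rw [show f + h - g = (f - g) + h by abel, norm_add_sq_real, inner_sub_left]
  have h3 : ⟪f, h⟫_ℝ - ⟪g, h⟫_ℝ =
      (η / m) * ∑ j, y j * h (x j) - η * ((1 / (m : ℝ)) * ∑ j, f (x j) * h (x j)) := by
    linarith
  have h4 : ∑ j, ((f + h) (x j) - y j) ^ 2 = ∑ j, (f (x j) - y j) ^ 2 +
      2 * (∑ j, f (x j) * h (x j) - ∑ j, y j * h (x j)) + ∑ j, h (x j) ^ 2 := by
    rw [← Finset.sum_sub_distrib, Finset.mul_sum, ← Finset.sum_add_distrib,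
      ← Finset.sum_add_distrib]
    refine Finset.sum_congr rfl fun j _ => ?_
    rw [RKHS.coe_add, Pi.add_apply]
    ring
  rw [proxObjective, proxObjective, empRisk, empRisk, h4, h2, h3]
  -- With no data, division by zero makes every data term `0`, and the identity holds trivially.
  rcases eq_or_ne (m : ℝ) 0 with hm | hm
  · simp [hm]; ring
  · field_simp
    ring

theorem argmin_proxObjective [FiniteDimensional ℝ H] {η : ℝ} (hη : 0 < η) (g : H) :
    argmin (proxObjective η x y g) =
      (Ring.inverse (1 + η • sampleOp H x)) (g + (η / m) • ∑ j, y j • rep H (x j)) := by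
  have hu := isUnit_one_add_smul (inner_sampleOp_self_nonneg (H := H) x) hη
  set f := (Ring.inverse (1 + η • sampleOp H x)) (g + (η / m) • ∑ j, y j • rep H (x j)) with hf
  have hfe : (1 + η • sampleOp H x) f = g + (η / m) • ∑ j, y j • rep H (x j) := by
    rw [hf, ← Module.End.mul_apply, Ring.mul_inverse_cancel _ hu, Module.End.one_apply]
  have hadd := fun h => proxObjective_add x y η hη.ne' g f h hfe
  have hmin : IsMinOn (proxObjective η x y g) Set.univ f := by
    intro f' _
    have h1 := hadd (f' - f)
    rw [add_sub_cancel] at h1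
    have : 0 ≤ (1 / (2 * (m : ℝ))) * ∑ j, (f' - f) (x j) ^ 2 + (1 / (2 * η)) * ‖f' - f‖ ^ 2 := by
      positivity
    simp only [Set.mem_ofPred_eq]
    linarith
  have hspec : IsMinOn (proxObjective η x y g) Set.univ (argmin (proxObjective η x y g)) :=
    Classical.epsilon_spec (p := fun f => IsMinOn (proxObjective η x y g) Set.univ f) ⟨f, hmin⟩
  set f' := argmin (proxObjective η x y g)
  have h1 := hadd (f' - f)
  rw [add_sub_cancel] at h1
  have h2 : proxObjective η x y g f' ≤ proxObjective η x y g f := hspec (Set.mem_univ f)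
  have h3 : 0 ≤ (1 / (2 * (m : ℝ))) * ∑ j, (f' - f) (x j) ^ 2 := by positivity
  have h4 : (1 / (2 * η)) * ‖f' - f‖ ^ 2 ≤ 0 := by linarith
  have h5 : 0 < 1 / (2 * η) := by positivity
  have h6 : ‖f' - f‖ ^ 2 = 0 := le_antisymm (by nlinarith) (sq_nonneg _)
  exact sub_eq_zero.mp (norm_eq_zero.mp (pow_eq_zero_iff two_ne_zero |>.mp h6))

variable (H) in
/-- The spectral filter of the sample operator that a client applies. -/
noncomputable def localFilter (alg : Algorithm) (η : ℝ) : Module.End ℝ H :=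
  match alg with
  | .fedAvg s => ∑ τ ∈ Finset.range s, (1 - η • sampleOp H x) ^ τ
  | .fedProx => Ring.inverse (1 + η • sampleOp H x)

/-- FedAvg gets this from the telescoping geometric sum, FedProx from the resolvent identity; from
here on both algorithms are handled through the filter alone. -/
theorem clientOp_eq [FiniteDimensional ℝ H] (alg : Algorithm) {η : ℝ} (hη : 0 < η) :
    clientOp H alg η x = 1 - η • (sampleOp H x * localFilter H x alg η) := by
  cases alg with
  | fedAvg s =>
    have := mul_neg_geom_sum (1 - η • sampleOp H x) s
    rw [sub_sub_cancel, smul_mul_assoc] at this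
    rw [clientOp, localFilter, this, sub_sub_cancel]
  | fedProx =>
    have hu := isUnit_one_add_smul (inner_sampleOp_self_nonneg (H := H) x) hη
    have := Ring.mul_inverse_cancel _ hu
    rw [add_mul, one_mul, smul_mul_assoc] at this
    rw [clientOp, localFilter]
    exact eq_sub_of_add_eq this

theorem clientPsi_eq (alg : Algorithm) (η : ℝ) (j : Fin m) :
    clientPsi H alg η x j = (η / m) • localFilter H x alg η (rep H (x j)) := by
  cases alg with
  | fedAvg s => simp [clientPsi, localFilter]
  | fedProx => rfl

theorem localUpdate_eq [FiniteDimensional ℝ H] (alg : Algorithm) {η : ℝ} (hη : 0 < η) (g : H) :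
    localUpdate alg η x y g = clientOp H alg η x g + ∑ j, y j • clientPsi H alg η x j := by
  have h : ∑ j, y j • clientPsi H alg η x j =
      localFilter H x alg η ((η / m) • ∑ j, y j • rep H (x j)) := by
    simp only [clientPsi_eq, map_smul, map_sum, Finset.smul_sum]
    exact Finset.sum_congr rfl fun j _ => smul_comm _ _ _
  rw [h]
  cases alg with
  | fedAvg s => exact iterate_affine (gradStep_eq x y η) s g
  | fedProx =>
    rw [localUpdate, argmin_proxObjective x y hη, map_add]
    rfl

theorem isLocalFilter_localFilter [FiniteDimensional ℝ H] (alg : Algorithm) {η γ : ℝ} (hη : 0 < η)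
    (hγ : 0 < γ) (hγ1 : alg ≠ .fedProx → γ < 1) (hx : η * specNorm (gram H x) ≤ γ) :
    IsLocalFilter η alg.localSteps (alg.kappa γ) (sampleOp H x) (localFilter H x alg η) := by
  have hT : ∀ f, η * ⟪sampleOp H x f, f⟫_ℝ ≤ γ * ‖f‖ ^ 2 := fun f => by
    have := mul_le_mul_of_nonneg_left (inner_sampleOp_self_le x f) hη.le
    nlinarith [mul_le_mul_of_nonneg_right hx (sq_nonneg ‖f‖)]
  cases alg with
  | fedAvg s =>
    exact isLocalFilter_fedAvg (sampleOp_isSymmetric x) (inner_sampleOp_self_nonneg x) hη hγ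
      (hγ1 (by simp)) hT s
  | fedProx =>
    have h := isLocalFilter_fedProx (sampleOp_isSymmetric x) (inner_sampleOp_self_nonneg x) hη hT
    rw [← Nat.cast_one] at h
    exact h

/-- The covariance identity for the vectors `Ψ_ij` of one client. -/
theorem sum_inner_clientPsi_sq {alg : Algorithm} {η κ : ℝ}
    (hA : IsLocalFilter η alg.localSteps κ (sampleOp H x) (localFilter H x alg η)) (f : H) :
    ∑ j, ⟪clientPsi H alg η x j, f⟫_ℝ ^ 2 =
      η ^ 2 / m * ⟪sampleOp H x (localFilter H x alg η f), localFilter H x alg η f⟫_ℝ := by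
  have h : ∀ j, ⟪clientPsi H alg η x j, f⟫_ℝ = η / m * localFilter H x alg η f (x j) := by
    intro j
    rw [clientPsi_eq, inner_smul_left, hA.symm, inner_rep_left, RCLike.conj_to_real]
  simp only [h, inner_sampleOp, mul_pow, ← Finset.mul_sum, ← pow_two]
  rw [← mul_assoc]
  congr 1
  rw [div_pow, div_mul_div_comm, mul_one, ← pow_two]

/-- Noiseless data contribute `η T A f`. -/
theorem sum_eval_smul_clientPsi {alg : Algorithm} {η κ : ℝ}
    (hA : IsLocalFilter η alg.localSteps κ (sampleOp H x) (localFilter H x alg η)) (f : H) :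
    ∑ j, f (x j) • clientPsi H alg η x j =
      (η • (sampleOp H x * localFilter H x alg η)) f := by
  rw [← hA.comm, LinearMap.smul_apply, Module.End.mul_apply, sampleOp_apply]
  simp only [clientPsi_eq, map_smul, map_sum, Finset.smul_sum]
  refine Finset.sum_congr rfl fun j _ => ?_
  rw [smul_smul, smul_smul, smul_smul]
  congr 1
  ring

end Client

/-! ### Second moment of a linear functional of the noise. -/

section Noise

variable {H : Type*} [NormedAddCommGroup H] [InnerProductSpace ℝ H]

/-- On expanding the square, linear terms vanish by centring and mixed products by independence;
only the variances remain. -/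
theorem IsNoiseLaw.integral_norm_sq_le {ι : Type*} [Fintype ι] {σ : ℝ} {P : Measure (ι → ℝ)}
    [IsProbabilityMeasure P] (hP : IsNoiseLaw σ P) (c : H) (v : ι → H) :
    Integrable (fun ξ : ι → ℝ => ‖c + ∑ p, ξ p • v p‖ ^ 2) P ∧
    ∫ ξ : ι → ℝ, ‖c + ∑ p, ξ p • v p‖ ^ 2 ∂P ≤ ‖c‖ ^ 2 + σ ^ 2 * ∑ p, ‖v p‖ ^ 2 := by
  have hexp : ∀ ξ : ι → ℝ, ‖c + ∑ p, ξ p • v p‖ ^ 2 =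
      ‖c‖ ^ 2 + ∑ p, ξ p * (2 * ⟪c, v p⟫_ℝ) + ∑ p, ∑ q, ξ p * ξ q * ⟪v p, v q⟫_ℝ := by
    intro ξ
    rw [norm_add_sq_real, ← real_inner_self_eq_norm_sq (∑ p, ξ p • v p)]
    simp only [inner_sum, sum_inner, inner_smul_left, inner_smul_right, RCLike.conj_to_real,
      Finset.mul_sum]
    congr 1
    · congr 1
      exact Finset.sum_congr rfl fun p _ => by ring
    · refine Finset.sum_congr rfl fun p _ => Finset.sum_congr rfl fun q _ => ?_
      rw [real_inner_comm]; ring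
  have i1 : ∀ p, Integrable (fun ξ : ι → ℝ => ξ p) P := fun p =>
    (hP.memLp p).integrable (by norm_num)
  have i2 : ∀ p q, Integrable (fun ξ : ι → ℝ => ξ p * ξ q) P := fun p q =>
    (hP.memLp p).integrable_mul (hP.memLp q)
  have j1 : Integrable (fun ξ : ι → ℝ => ∑ p, ξ p * (2 * ⟪c, v p⟫_ℝ)) P :=
    integrable_finsetSum _ fun p _ => (i1 p).mul_const _
  have j2 : ∀ p, Integrable (fun ξ : ι → ℝ => ∑ q, ξ p * ξ q * ⟪v p, v q⟫_ℝ) P := fun p =>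
    integrable_finsetSum _ fun q _ => (i2 p q).mul_const _
  have j3 : Integrable (fun ξ : ι → ℝ => ∑ p, ∑ q, ξ p * ξ q * ⟪v p, v q⟫_ℝ) P :=
    integrable_finsetSum _ fun p _ => j2 p
  have j0 : Integrable (fun _ : ι → ℝ => ‖c‖ ^ 2) P := integrable_const _
  simp only [hexp]
  refine ⟨(j0.add j1).add j3, ?_⟩
  have j01 : Integrable (fun ξ : ι → ℝ => ‖c‖ ^ 2 + ∑ p, ξ p * (2 * ⟪c, v p⟫_ℝ)) P := j0.add j1
  rw [integral_add j01 j3, integral_add j0 j1, integral_finsetSum _ fun p _ => j2 p,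
    integral_finsetSum _ fun p _ => (i1 p).mul_const _]
  simp only [integral_mul_const, hP.mean, zero_mul, Finset.sum_const_zero, add_zero,
    integral_const, probReal_univ, one_smul]
  gcongr
  rw [Finset.mul_sum]
  refine Finset.sum_le_sum fun p _ => ?_
  rw [integral_finsetSum _ fun q _ => (i2 p q).mul_const _, Finset.sum_eq_single p]
  · rw [integral_mul_const, real_inner_self_eq_norm_sq]
    gcongr
    have h := hP.var p
    rw [variance_of_integral_eq_zero (i1 p).aemeasurable (hP.mean p)] at h
    simpa [pow_two] using h
  · intro q _ hq
    have hind := hP.indep.indepFun (Ne.symm hq)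
    have : ∫ ξ : ι → ℝ, ξ p * ξ q ∂P = 0 := by
      have := hind.integral_fun_mul_eq_mul_integral (i1 p).aestronglyMeasurable
        (i1 q).aestronglyMeasurable
      rw [this, hP.mean, zero_mul]
    rw [integral_mul_const, this, zero_mul]
  · simp

end Noise

/-! ### Dynamics, energy and fixed point of the global model. -/

section Global

variable {X H : Type*} [NormedAddCommGroup H] [InnerProductSpace ℝ H] [CompleteSpace H]
  [RKHS ℝ H X ℝ] {M : ℕ} {n : Fin M → ℕ} (x : (i : Fin M) → Fin (n i) → X)

theorem weight_nonneg (n : Fin M → ℕ) (i : Fin M) : 0 ≤ weight n i := by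
  unfold weight; positivity

theorem sum_weight (hn : 0 < ∑ i, n i) : ∑ i, weight n i = 1 := by
  have h : ((∑ i, n i : ℕ) : ℝ) ≠ 0 := by exact_mod_cast hn.ne'
  simp only [weight, ← Finset.sum_div]
  rw [← Nat.cast_sum, div_self h]

theorem globalModel_succ [FiniteDimensional ℝ H] (alg : Algorithm) {η : ℝ} (hη : 0 < η)
    (y : (i : Fin M) → Fin (n i) → ℝ) (f₀ : H) (t : ℕ) :
    globalModel alg η x y f₀ (t + 1) =
      globalOp H alg η x (globalModel alg η x y f₀ t) + dotPsi H alg η x y := by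
  rw [globalModel]
  simp only [localUpdate_eq _ _ alg hη, smul_add, Finset.sum_add_distrib]
  simp [globalOp, dotPsi]

theorem dotPsi_responses (alg : Algorithm) (η : ℝ) (fStar : Fin M → H)
    (ξ : (Σ i : Fin M, Fin (n i)) → ℝ) :
    dotPsi H alg η x (responses x fStar ξ) =
      dotPsi H alg η x (fun i j => fStar i (x i j)) +
        ∑ p : Σ i : Fin M, Fin (n i), ξ p • (weight n p.1 • clientPsi H alg η (x p.1) p.2) := by
  rw [Fintype.sum_sigma]
  simp only [dotPsi, responses, add_smul, Finset.sum_add_distrib, smul_add]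
  congr 1
  refine Finset.sum_congr rfl fun i _ => ?_
  rw [Finset.smul_sum]
  exact Finset.sum_congr rfl fun j _ => smul_comm _ _ _

/-- `f̄` is fixed by the noiseless affine iteration, so the deviation follows a linear iteration
driven by the noise alone. -/
theorem globalModel_sub [FiniteDimensional ℝ H] (alg : Algorithm) {η : ℝ} (hη : 0 < η)
    (fStar : Fin M → H) (ξ : (Σ i : Fin M, Fin (n i)) → ℝ) (f₀ : H)
    (hu : IsUnit (1 - globalOp H alg η x)) (t : ℕ) :
    globalModel alg η x (responses x fStar ξ) f₀ t - fBar alg η x fStar =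
      (globalOp H alg η x ^ t) (f₀ - fBar alg η x fStar) +
        ∑ p : Σ i : Fin M, Fin (n i), ξ p • ∑ τ ∈ Finset.range t,
          (globalOp H alg η x ^ τ) (weight n p.1 • clientPsi H alg η (x p.1) p.2) := by
  have hfix : dotPsi H alg η x (fun i j => fStar i (x i j)) =
      fBar alg η x fStar - globalOp H alg η x (fBar alg η x fStar) := by
    have h : ((1 - globalOp H alg η x) * Ring.inverse (1 - globalOp H alg η x))
        (dotPsi H alg η x fun i j => fStar i (x i j)) =
        dotPsi H alg η x fun i j => fStar i (x i j) := by
      rw [Ring.mul_inverse_cancel _ hu, Module.End.one_apply]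
    rw [← h, Module.End.mul_apply, LinearMap.sub_apply, Module.End.one_apply]
    rfl
  have hiter : ∀ t, globalModel alg η x (responses x fStar ξ) f₀ t - fBar alg η x fStar =
      (fun g => globalOp H alg η x g +
        ∑ p : Σ i : Fin M, Fin (n i), ξ p • (weight n p.1 • clientPsi H alg η (x p.1) p.2))^[t]
          (f₀ - fBar alg η x fStar) := by
    intro t
    induction t with
    | zero => rfl
    | succ t ih =>
      rw [Function.iterate_succ_apply', ← ih, globalModel_succ x alg hη, dotPsi_responses, hfix,
        map_sub]
      abel
  rw [hiter, iterate_affine (fun _ => rfl), map_sum]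
  simp only [map_smul, LinearMap.sum_apply, Finset.smul_sum]

variable {x} {alg : Algorithm} {η κ : ℝ}

theorem one_sub_globalOp [FiniteDimensional ℝ H] (hη : 0 < η) (hn : 0 < ∑ i, n i) :
    1 - globalOp H alg η x =
      ∑ i, weight n i • η • (sampleOp H (x i) * localFilter H (x i) alg η) := by
  simp only [globalOp, clientOp_eq _ alg hη, smul_sub, Finset.sum_sub_distrib, ← Finset.sum_smul,
    sum_weight hn, one_smul, sub_sub_cancel]

theorem inner_one_sub_globalOp [FiniteDimensional ℝ H] (hη : 0 < η) (hn : 0 < ∑ i, n i)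
    (f g : H) : ⟪(1 - globalOp H alg η x) f, g⟫_ℝ =
      ∑ i, weight n i * (η * ⟪sampleOp H (x i) (localFilter H (x i) alg η f), g⟫_ℝ) := by
  rw [one_sub_globalOp hη hn]
  simp [sum_inner, inner_smul_left]

theorem IsLocalFilter.inner_comm {H : Type*} [NormedAddCommGroup H] [InnerProductSpace ℝ H]
    {η κ s : ℝ} {T A : Module.End ℝ H} (hA : IsLocalFilter η s κ T A)
    (hT : T.IsSymmetric) (f g : H) : ⟪T (A f), g⟫_ℝ = ⟪f, T (A g)⟫_ℝ := by
  rw [hT, hA.symm, ← Module.End.mul_apply, hA.comm, Module.End.mul_apply]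

theorem globalOp_isSymmetric [FiniteDimensional ℝ H] (hη : 0 < η) (hn : 0 < ∑ i, n i)
    (hA : ∀ i, IsLocalFilter η alg.localSteps κ (sampleOp H (x i)) (localFilter H (x i) alg η)) :
    (globalOp H alg η x).IsSymmetric := by
  intro f g
  have h : ⟪(1 - globalOp H alg η x) f, g⟫_ℝ = ⟪f, (1 - globalOp H alg η x) g⟫_ℝ := by
    rw [inner_one_sub_globalOp hη hn, ← real_inner_comm, inner_one_sub_globalOp hη hn]
    refine Finset.sum_congr rfl fun i _ => ?_
    rw [(hA i).inner_comm (sampleOp_isSymmetric _), real_inner_comm]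
  simp only [LinearMap.sub_apply, Module.End.one_apply, inner_sub_left, inner_sub_right] at h
  linarith

theorem inner_globalOp_self_nonneg [FiniteDimensional ℝ H] (hη : 0 < η) (hn : 0 < ∑ i, n i)
    (hA : ∀ i, IsLocalFilter η alg.localSteps κ (sampleOp H (x i)) (localFilter H (x i) alg η))
    (f : H) : 0 ≤ ⟪globalOp H alg η x f, f⟫_ℝ := by
  have h := inner_one_sub_globalOp (alg := alg) (x := x) hη hn f f
  rw [LinearMap.sub_apply, inner_sub_left, Module.End.one_apply, real_inner_self_eq_norm_sq] at h
  have h1 : ∑ i, weight n i * (η * ⟪sampleOp H (x i) (localFilter H (x i) alg η f), f⟫_ℝ) ≤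
      ∑ i, weight n i * ‖f‖ ^ 2 := Finset.sum_le_sum fun i _ =>
    mul_le_mul_of_nonneg_left ((hA i).le_one f) (weight_nonneg n i)
  rw [← Finset.sum_mul, sum_weight hn] at h1
  linarith

theorem le_inner_one_sub_globalOp [FiniteDimensional ℝ H] (hη : 0 < η) (hn : 0 < ∑ i, n i)
    (hA : ∀ i, IsLocalFilter η alg.localSteps κ (sampleOp H (x i)) (localFilter H (x i) alg η))
    (hκ : 0 < κ) {α : ℝ}
    (hα : ∀ f : H, α / 2 * ‖f‖ ^ 2 ≤ ∑ i, weight n i * ⟪sampleOp H (x i) f, f⟫_ℝ) (f : H) :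
    alg.localSteps * η * α / (2 * κ) * ‖f‖ ^ 2 ≤ ⟪(1 - globalOp H alg η x) f, f⟫_ℝ := by
  rw [inner_one_sub_globalOp hη hn]
  have hc : 0 ≤ (alg.localSteps : ℝ) / κ * η := by positivity
  calc _ = (alg.localSteps : ℝ) / κ * η * (α / 2 * ‖f‖ ^ 2) := by field_simp
    _ ≤ (alg.localSteps : ℝ) / κ * η * ∑ i, weight n i * ⟪sampleOp H (x i) f, f⟫_ℝ :=
      mul_le_mul_of_nonneg_left (hα f) hc
    _ ≤ _ := by
      rw [Finset.mul_sum]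
      refine Finset.sum_le_sum fun i _ => ?_
      have := mul_le_mul_of_nonneg_left ((hA i).lower f) (weight_nonneg n i)
      linarith

/-- The covariance of client `i` is quadratic in the filter; bounding one filter factor by `s`
leaves the summand of `1 - L`. The factor `1/N` is `w_i / n_i`. -/
theorem sum_inner_weighted_clientPsi_sq_le [FiniteDimensional ℝ H] (hη : 0 < η)
    (hni : ∀ i, 0 < n i) (hn : 0 < ∑ i, n i)
    (hA : ∀ i, IsLocalFilter η alg.localSteps κ (sampleOp H (x i)) (localFilter H (x i) alg η))
    (f : H) :
    ∑ p : Σ i : Fin M, Fin (n i), ⟪weight n p.1 • clientPsi H alg η (x p.1) p.2, f⟫_ℝ ^ 2 ≤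
      η * alg.localSteps / ((∑ i, n i : ℕ) : ℝ) * ⟪(1 - globalOp H alg η x) f, f⟫_ℝ := by
  rw [Fintype.sum_sigma, inner_one_sub_globalOp hη hn, Finset.mul_sum]
  refine Finset.sum_le_sum fun i _ => ?_
  simp only [inner_smul_left, RCLike.conj_to_real, mul_pow]
  rw [← Finset.mul_sum, sum_inner_clientPsi_sq (x i) (hA i)]
  have hi : (0 : ℝ) < n i := by exact_mod_cast hni i
  have hN : (0 : ℝ) < ((∑ i, n i : ℕ) : ℝ) := by exact_mod_cast hn
  have h := mul_le_mul_of_nonneg_left ((hA i).sq_upper f)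
    (by positivity : 0 ≤ weight n i ^ 2 * (η / n i))
  · calc _ = weight n i ^ 2 * (η / n i) * (η * ⟪sampleOp H (x i) (localFilter H (x i) alg η f),
          localFilter H (x i) alg η f⟫_ℝ) := by ring
      _ ≤ _ := h
      _ = _ := by
        have : weight n i ^ 2 * (η / n i) = weight n i * (η / ((∑ i, n i : ℕ) : ℝ)) := by
          unfold weight; field_simp
        rw [this]; ring

/-- Let `B_i = η T_i A_i`, `h = f̄ - f_j^*` and `g_i = f_i^* - f_j^*`. Then `(1 - L) h = ∑ w_i B_i
g_i`. Pairing with `h` and using `2⟪B_i g_i, h⟫ ≤ ⟪B_i g_i, g_i⟫ + ⟪B_i h, h⟫` absorbs half of the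
energy of `h`, so no inverse of `1 - L` has to be estimated in norm. -/
theorem norm_fBar_sub_sq_le [FiniteDimensional ℝ H] (hη : 0 < η) (hn : 0 < ∑ i, n i)
    (hA : ∀ i, IsLocalFilter η alg.localSteps κ (sampleOp H (x i)) (localFilter H (x i) alg η))
    (hκ : 0 < κ) (hu : IsUnit (1 - globalOp H alg η x)) {ρ : ℝ}
    (hLρ : ∀ f, ρ * ‖f‖ ^ 2 ≤ ⟪(1 - globalOp H alg η x) f, f⟫_ℝ)
    {τ : Fin M → ℝ} (hτ0 : ∀ i, 0 ≤ τ i)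
    (hτ : ∀ i (f : H), ⟪sampleOp H (x i) f, f⟫_ℝ ≤ τ i * ‖f‖ ^ 2)
    (fStar : Fin M → H) (j : Fin M) :
    ρ * ‖fBar alg η x fStar - fStar j‖ ^ 2 ≤
      alg.localSteps * η * (∑ i, weight n i * τ i) * modelGap fStar ^ 2 := by
  set B : Fin M → Module.End ℝ H := fun i =>
    η • (sampleOp H (x i) * localFilter H (x i) alg η) with hB
  have hL : 1 - globalOp H alg η x = ∑ i, weight n i • B i := one_sub_globalOp hη hn
  set h := fBar alg η x fStar - fStar j with hh
  have hBi : ∀ i f g, ⟪B i f, g⟫_ℝ =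
      η * ⟪sampleOp H (x i) (localFilter H (x i) alg η f), g⟫_ℝ := by
    intro i f g
    simp [hB, inner_smul_left]
  have hBsymm : ∀ i f g, ⟪B i f, g⟫_ℝ = ⟪B i g, f⟫_ℝ := by
    intro i f g
    rw [hBi, hBi, (hA i).inner_comm (sampleOp_isSymmetric _), real_inner_comm]
  have hB0 : ∀ i f, 0 ≤ ⟪B i f, f⟫_ℝ := by
    intro i f
    rw [hBi]
    refine le_trans ?_ ((hA i).lower f)
    have := inner_sampleOp_self_nonneg (x i) f
    positivity
  have hLh : (1 - globalOp H alg η x) h = ∑ i, weight n i • B i (fStar i - fStar j) := by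
    have h1 : (1 - globalOp H alg η x) (fBar alg η x fStar) =
        ∑ i, weight n i • B i (fStar i) := by
      have e : ((1 - globalOp H alg η x) * Ring.inverse (1 - globalOp H alg η x))
          (dotPsi H alg η x fun i j => fStar i (x i j)) =
          dotPsi H alg η x fun i j => fStar i (x i j) := by
        rw [Ring.mul_inverse_cancel _ hu, Module.End.one_apply]
      rw [Module.End.mul_apply] at e
      rw [fBar, e, dotPsi]
      exact Finset.sum_congr rfl fun i _ => by rw [sum_eval_smul_clientPsi (x i) (hA i)]
    have h2 : (1 - globalOp H alg η x) (fStar j) = ∑ i, weight n i • B i (fStar j) := by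
      rw [hL]; simp
    rw [hh, map_sub, h1, h2, ← Finset.sum_sub_distrib]
    exact Finset.sum_congr rfl fun i _ => by rw [map_sub, smul_sub]
  set Q := ⟪(1 - globalOp H alg η x) h, h⟫_ℝ with hQ
  have hQ1 : Q = ∑ i, weight n i * ⟪B i (fStar i - fStar j), h⟫_ℝ := by
    rw [hQ, hLh]; simp [sum_inner, inner_smul_left]
  have hQ2 : Q = ∑ i, weight n i * ⟪B i h, h⟫_ℝ := by
    rw [hQ, hL]; simp [sum_inner, inner_smul_left]
  have hG : ∑ i, weight n i * ⟪B i (fStar i - fStar j), fStar i - fStar j⟫_ℝ ≤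
      alg.localSteps * η * (∑ i, weight n i * τ i) * modelGap fStar ^ 2 := by
    rw [mul_assoc, Finset.sum_mul, Finset.mul_sum]
    refine Finset.sum_le_sum fun i _ => ?_
    have hgap : ‖fStar i - fStar j‖ ≤ modelGap fStar :=
      le_ciSup (f := fun p : Fin M × Fin M => ‖fStar p.1 - fStar p.2‖)
        (Set.finite_range _).bddAbove (i, j)
    have h1 : ⟪sampleOp H (x i) (fStar i - fStar j), fStar i - fStar j⟫_ℝ ≤
        τ i * modelGap fStar ^ 2 := by
      refine (hτ i _).trans ?_
      have := hτ0 i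
      gcongr
    have h2 := (hA i).upper (fStar i - fStar j)
    rw [← hBi] at h2
    have h3 := mul_le_mul_of_nonneg_left h1
      (by positivity : 0 ≤ (alg.localSteps : ℝ) * η)
    have h4 := mul_le_mul_of_nonneg_left (h2.trans (by linarith : _ ≤ (alg.localSteps : ℝ) * η *
      (τ i * modelGap fStar ^ 2))) (weight_nonneg n i)
    linarith
  have hQG : Q ≤ ∑ i, weight n i * ⟪B i (fStar i - fStar j), fStar i - fStar j⟫_ℝ := by
    have hsq : ∀ i, 2 * ⟪B i (fStar i - fStar j), h⟫_ℝ ≤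
        ⟪B i (fStar i - fStar j), fStar i - fStar j⟫_ℝ + ⟪B i h, h⟫_ℝ := by
      intro i
      have h0 := hB0 i (fStar i - fStar j - h)
      generalize fStar i - fStar j = g at h0 ⊢
      rw [map_sub, inner_sub_left, inner_sub_right _ g h, inner_sub_right _ g h,
        hBsymm i h g] at h0
      linarith
    have h1 : 2 * Q ≤ ∑ i, weight n i * ⟪B i (fStar i - fStar j), fStar i - fStar j⟫_ℝ + Q := by
      nth_rewrite 2 [hQ2]
      rw [hQ1, Finset.mul_sum, ← Finset.sum_add_distrib]
      refine Finset.sum_le_sum fun i _ => ?_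
      have := mul_le_mul_of_nonneg_left (hsq i) (weight_nonneg n i)
      linarith
    linarith
  exact (hLρ h).trans (hQG.trans hG)

end Global

/-! ### From the subspace factorization to bounds on the sample operators. -/

section Features

theorem minEigenvalue_mul_le {m : ℕ} {A : Matrix (Fin m) (Fin m) ℝ} (hA : A.IsSymm)
    (v : Fin m → ℝ) : minEigenvalue A * (v ⬝ᵥ v) ≤ v ⬝ᵥ (A *ᵥ v) := by
  have hH : A.IsHermitian := by
    rw [Matrix.IsHermitian, conjTranspose_eq_transpose_of_trivial]; exact hA
  have hmin : ∀ k, minEigenvalue A ≤ hH.eigenvalues k := by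
    intro k
    rw [minEigenvalue, hH.spectrum_real_eq_range_eigenvalues]
    exact csInf_le (Set.finite_range _).bddBelow ⟨k, rfl⟩
  have hD : ∀ k, Matrix.toEuclideanLin A (hH.eigenvectorBasis k) =
      hH.eigenvalues k • hH.eigenvectorBasis k := by
    intro k
    have := hH.mulVec_eigenvectorBasis k
    rw [Matrix.toLpLin_apply, this]
    rfl
  have h1 : v ⬝ᵥ (A *ᵥ v) = ⟪Matrix.toEuclideanLin A (WithLp.toLp 2 v), WithLp.toLp 2 v⟫_ℝ := by
    simp [EuclideanSpace.inner_eq_star_dotProduct, Matrix.toLpLin_apply]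
  have h2 : v ⬝ᵥ v = ‖WithLp.toLp 2 v‖ ^ 2 := by
    rw [EuclideanSpace.real_norm_sq_eq]
    simp [dotProduct, pow_two]
  rw [h1, h2, inner_apply_of_diagonal hH.eigenvectorBasis hD,
    norm_sq_eq_sum_inner_sq hH.eigenvectorBasis, Finset.mul_sum]
  refine Finset.sum_le_sum fun k _ => ?_
  rw [← pow_two]
  exact mul_le_mul_of_nonneg_right (hmin k) (sq_nonneg _)

theorem isSymm_smul_transpose_mul_self {n r : ℕ} (c : ℝ) (F : Matrix (Fin n) (Fin r) ℝ) :
    (c • (Fᵀ * F)).IsSymm := by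
  simp [Matrix.IsSymm]

/-- Without rows `Fᵀ F` vanishes, and testing on the all-ones vector, nonzero because `r > 0`, would
force `α ≤ 0`. -/
theorem IsConditioned.pos {α β : ℝ} (hα : 0 < α) {n r : ℕ} (hr : 0 < r)
    {F : Matrix (Fin n) (Fin r) ℝ} (hF : IsConditioned α β F) : 0 < n := by
  rcases Nat.eq_zero_or_pos n with rfl | hn
  · have h := minEigenvalue_mul_le
      (isSymm_smul_transpose_mul_self (1 / ((0 : ℕ) : ℝ)) F) (fun _ => 1)
    have h1 : (0 : ℝ) < (fun _ : Fin r => (1 : ℝ)) ⬝ᵥ (fun _ => 1) := by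
      simpa [dotProduct] using hr
    have h2 := mul_le_mul_of_nonneg_right hF.1 h1.le
    simp at h h2
    nlinarith
  · exact hn

theorem isSymm_and_idempotent_of_orthonormal {d r : ℕ} {U : Matrix (Fin d) (Fin r) ℝ}
    (hU : Uᵀ * U = 1) : (U * Uᵀ).IsSymm ∧ U * Uᵀ * (U * Uᵀ) = U * Uᵀ := by
  refine ⟨by simp [Matrix.IsSymm], ?_⟩
  rw [Matrix.mul_assoc, ← Matrix.mul_assoc Uᵀ, hU, Matrix.one_mul]

variable {X H : Type*} [NormedAddCommGroup H] [InnerProductSpace ℝ H] [CompleteSpace H]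
  [RKHS ℝ H X ℝ] {d m r : ℕ} (b : OrthonormalBasis (Fin d) ℝ H)

theorem featureMatrix_mulVec (x : Fin m → X) (f : H) (j : Fin m) :
    (featureMatrix b x *ᵥ (b.repr f).ofLp) j = f (x j) := by
  conv_rhs => rw [← b.sum_repr f, coe_sum_apply]
  simp [mulVec, dotProduct, featureMatrix, mul_comm]

theorem inner_sampleOp_eq_of_factor {x : Fin m → X} {F : Matrix (Fin m) (Fin r) ℝ}
    {U : Matrix (Fin d) (Fin r) ℝ} (hx : featureMatrix b x = √((d : ℝ) / r) • (F * Uᵀ)) (f : H) :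
    ⟪sampleOp H x f, f⟫_ℝ = (d : ℝ) / r *
      ((Uᵀ *ᵥ (b.repr f).ofLp) ⬝ᵥ
        (((1 / (m : ℝ)) • (Fᵀ * F)) *ᵥ (Uᵀ *ᵥ (b.repr f).ofLp))) := by
  rw [inner_sampleOp]
  simp only [← featureMatrix_mulVec b x f, hx, smul_mulVec, ← mulVec_mulVec, Pi.smul_apply,
    smul_eq_mul, dotProduct_smul]
  generalize Uᵀ *ᵥ (b.repr f).ofLp = u
  have h1 : u ⬝ᵥ (Fᵀ *ᵥ (F *ᵥ u)) = ∑ j, (F *ᵥ u) j * (F *ᵥ u) j := by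
    rw [dotProduct_mulVec, vecMul_transpose]
    rfl
  have h2 : ∑ j, √((d : ℝ) / r) * (F *ᵥ u) j * (√((d : ℝ) / r) * (F *ᵥ u) j) =
      (d : ℝ) / r * ∑ j, (F *ᵥ u) j * (F *ᵥ u) j := by
    rw [Finset.mul_sum]
    refine Finset.sum_congr rfl fun j _ => ?_
    rw [mul_mul_mul_comm, Real.mul_self_sqrt (by positivity)]
  rw [h1, h2]
  ring

theorem dotProduct_transpose_mulVec_self (U : Matrix (Fin d) (Fin r) ℝ) (v : Fin d → ℝ) :
    (Uᵀ *ᵥ v) ⬝ᵥ (Uᵀ *ᵥ v) = v ⬝ᵥ ((U * Uᵀ) *ᵥ v) := by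
  rw [← mulVec_mulVec, dotProduct_mulVec v, ← mulVec_transpose]

theorem dotProduct_repr_self {H : Type*} [NormedAddCommGroup H] [InnerProductSpace ℝ H]
    (b : OrthonormalBasis (Fin d) ℝ H) (f : H) : (b.repr f).ofLp ⬝ᵥ (b.repr f).ofLp = ‖f‖ ^ 2 := by
  rw [← b.repr.norm_map f, EuclideanSpace.real_norm_sq_eq]
  simp [dotProduct, pow_two]

theorem le_inner_sampleOp_of_factor {x : Fin m → X} {F : Matrix (Fin m) (Fin r) ℝ}
    {U : Matrix (Fin d) (Fin r) ℝ} (hx : featureMatrix b x = √((d : ℝ) / r) • (F * Uᵀ))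
    {α β : ℝ} (hF : IsConditioned α β F) (f : H) :
    (d : ℝ) / r * (α * ((b.repr f).ofLp ⬝ᵥ ((U * Uᵀ) *ᵥ (b.repr f).ofLp))) ≤
      ⟪sampleOp H x f, f⟫_ℝ := by
  rw [inner_sampleOp_eq_of_factor b hx, ← dotProduct_transpose_mulVec_self]
  refine mul_le_mul_of_nonneg_left ?_ (by positivity)
  refine le_trans ?_ (minEigenvalue_mul_le (isSymm_smul_transpose_mul_self _ F) _)
  refine mul_le_mul_of_nonneg_right hF.1 ?_
  exact Finset.sum_nonneg fun k _ => mul_self_nonneg _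

theorem inner_sampleOp_le_of_factor {x : Fin m → X} {F : Matrix (Fin m) (Fin r) ℝ}
    {U : Matrix (Fin d) (Fin r) ℝ} (hx : featureMatrix b x = √((d : ℝ) / r) • (F * Uᵀ))
    (hU : Uᵀ * U = 1) {α β : ℝ} (hβ : 0 ≤ β) (hF : IsConditioned α β F) (f : H) :
    ⟪sampleOp H x f, f⟫_ℝ ≤ (d : ℝ) / r * β * ‖f‖ ^ 2 := by
  rw [inner_sampleOp_eq_of_factor b hx, mul_assoc]
  refine mul_le_mul_of_nonneg_left ?_ (by positivity)
  refine (inner_mulVec_le_specNorm _ _).trans ?_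
  set v := (b.repr f).ofLp with hv
  have h0 : 0 ≤ (Uᵀ *ᵥ v) ⬝ᵥ (Uᵀ *ᵥ v) := Finset.sum_nonneg fun k _ => mul_self_nonneg _
  have h1 : (Uᵀ *ᵥ v) ⬝ᵥ (Uᵀ *ᵥ v) ≤ ‖f‖ ^ 2 := by
    -- The squared distance from `v` to the column space of `U` is `‖v‖² - ‖Uᵀ v‖²`, so `Uᵀ` is a
    -- contraction.
    have h2 : 0 ≤ (v - (U * Uᵀ) *ᵥ v) ⬝ᵥ (v - (U * Uᵀ) *ᵥ v) :=
      Finset.sum_nonneg fun k _ => mul_self_nonneg _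
    obtain ⟨hs, hi⟩ := isSymm_and_idempotent_of_orthonormal hU
    have h3 : ((U * Uᵀ) *ᵥ v) ⬝ᵥ ((U * Uᵀ) *ᵥ v) = v ⬝ᵥ ((U * Uᵀ) *ᵥ v) := by
      conv_rhs => rw [← hi, ← mulVec_mulVec, dotProduct_mulVec, ← mulVec_transpose, hs.eq]
    rw [sub_dotProduct, dotProduct_sub, dotProduct_sub, h3, dotProduct_comm ((U * Uᵀ) *ᵥ v) v,
      dotProduct_repr_self b] at h2
    rw [dotProduct_transpose_mulVec_self]
    linarith
  exact (mul_le_mul_of_nonneg_right hF.2 h0).trans (mul_le_mul_of_nonneg_left h1 hβ)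

end Features

/-! ### The conclusions for fixed covariates with good spectral bounds. -/

section Conclusion

variable {X H : Type*} [NormedAddCommGroup H] [InnerProductSpace ℝ H] [CompleteSpace H]
  [RKHS ℝ H X ℝ] {d M : ℕ} {n r : Fin M → ℕ}

/-- An average of the `T_i` cannot exceed the largest Gram norm, so a positive lower bound on the
average forces `γ > 0`. This keeps `κ` positive. -/
theorem gammaOf_pos {η α : ℝ} (hη : 0 < η) (hα : 0 < α) (hn : 0 < ∑ i, n i)
    {x : (i : Fin M) → Fin (n i) → X} [Nontrivial H]
    (hlow : ∀ f : H, α / 2 * ‖f‖ ^ 2 ≤ ∑ i, weight n i * ⟪sampleOp H (x i) f, f⟫_ℝ) :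
    0 < gammaOf H η x := by
  obtain ⟨f, hf⟩ := exists_ne (0 : H)
  have hle : ∀ i, specNorm (gram H (x i)) ≤ ⨆ i, specNorm (gram H (x i)) := fun i =>
    le_ciSup (f := fun i => specNorm (gram H (x i))) (Set.finite_range _).bddAbove i
  have h1 : ∑ i, weight n i * ⟪sampleOp H (x i) f, f⟫_ℝ ≤
      ∑ i, weight n i * ((⨆ i, specNorm (gram H (x i))) * ‖f‖ ^ 2) :=
    Finset.sum_le_sum fun i _ => mul_le_mul_of_nonneg_left
      ((inner_sampleOp_self_le (x i) f).trans
        (mul_le_mul_of_nonneg_right (hle i) (sq_nonneg _))) (weight_nonneg n i)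
  rw [← Finset.sum_mul, sum_weight hn, one_mul] at h1
  have h2 : 0 < ‖f‖ ^ 2 := by positivity
  have h3 : α / 2 ≤ ⨆ i, specNorm (gram H (x i)) :=
    le_of_mul_le_mul_right ((hlow f).trans h1) h2
  exact mul_pos hη (by linarith)

theorem convergence_of_spectral_bounds (b : OrthonormalBasis (Fin d) ℝ H) (hd : 0 < d)
    (hni : ∀ i, 0 < n i) (hn : 0 < ∑ i, n i) (alg : Algorithm) (hs : 1 ≤ alg.localSteps) {η : ℝ}
    (hη : 0 < η) (f₀ : H) (fStar : Fin M → H) {σ α β : ℝ} (hα : 0 < α) (hβ : 0 < β)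
    {x : (i : Fin M) → Fin (n i) → X} {P : Measure ((Σ i : Fin M, Fin (n i)) → ℝ)}
    [IsProbabilityMeasure P] (hP : IsNoiseLaw σ P)
    (hγ1 : alg ≠ .fedProx → gammaOf H η x < 1)
    (hlow : ∀ f : H, α / 2 * ‖f‖ ^ 2 ≤ ∑ i, weight n i * ⟪sampleOp H (x i) f, f⟫_ℝ)
    (hup : ∀ i (f : H), ⟪sampleOp H (x i) f, f⟫_ℝ ≤ (d : ℝ) / r i * β * ‖f‖ ^ 2) {ν : ℝ}
    (hν : ∀ i, (n i : ℝ) / r i ≤ ν) (hν0 : 0 ≤ ν) {κ : ℝ}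
    (hκ : κ = alg.kappa (gammaOf H η x)) {N : ℕ} (hN : N = ∑ i, n i) :
    IsUnit (1 - globalOp H alg η x) ∧
    (∀ t : ℕ,
      Integrable (fun ξ => ‖b.repr (globalModel alg η x (responses x fStar ξ) f₀ t) -
        b.repr (fBar alg η x fStar)‖ ^ 2) P ∧
      ∫ ξ, ‖b.repr (globalModel alg η x (responses x fStar ξ) f₀ t) -
        b.repr (fBar alg η x fStar)‖ ^ 2 ∂P ≤
        (1 - alg.localSteps * η * α / (2 * κ)) ^ (2 * t) *
            ‖b.repr f₀ - b.repr (fBar alg η x fStar)‖ ^ 2 +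
          σ ^ 2 * (2 * κ * d / (N * α))) ∧
    ∀ j : Fin M,
      ‖b.repr (fBar alg η x fStar) - b.repr (fStar j)‖ ≤
        modelGap fStar * √(2 * κ * β * ν * M * d / (α * N)) := by
  have : FiniteDimensional ℝ H := b.toBasis.finiteDimensional_of_finite
  have hrank : Module.finrank ℝ H = d := by
    rw [Module.finrank_eq_card_basis b.toBasis, Fintype.card_fin]
  have : Nontrivial H := Module.nontrivial_of_finrank_pos (R := ℝ) (by rw [hrank]; exact hd)
  have hγ0 := gammaOf_pos hη hα hn hlow
  have hκ0 : 0 < κ := hκ ▸ kappa_pos hγ0 alg hs hγ1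
  have hs0 : (0 : ℝ) < alg.localSteps := by exact_mod_cast hs
  have hN0 : (0 : ℝ) < N := by rw [hN]; exact_mod_cast hn
  have hd0 : (0 : ℝ) < d := by exact_mod_cast hd
  have hA : ∀ i, IsLocalFilter η alg.localSteps κ (sampleOp H (x i))
      (localFilter H (x i) alg η) := fun i => by
    rw [hκ]
    exact isLocalFilter_localFilter (x i) alg hη hγ0 hγ1 (mul_le_mul_of_nonneg_left
      (le_ciSup (f := fun i => specNorm (gram H (x i))) (Set.finite_range _).bddAbove i) hη.le)
  set ρ := alg.localSteps * η * α / (2 * κ) with hρ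
  have hρ0 : 0 < ρ := by positivity
  have hLρ : ∀ f : H, ρ * ‖f‖ ^ 2 ≤ ⟪(1 - globalOp H alg η x) f, f⟫_ℝ :=
    le_inner_one_sub_globalOp hη hn hA hκ0 hlow
  have hu : IsUnit (1 - globalOp H alg η x) := isUnit_of_coercive hρ0 hLρ
  simp only [← map_sub, LinearIsometryEquiv.norm_map]
  refine ⟨hu, fun t => ?_, fun j => ?_⟩
  · simp only [globalModel_sub x alg hη fStar _ f₀ hu t]
    obtain ⟨hint, hle⟩ := hP.integral_norm_sq_le
      ((globalOp H alg η x ^ t) (f₀ - fBar alg η x fStar))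
      (fun p : Σ i : Fin M, Fin (n i) => ∑ τ ∈ Finset.range t,
        (globalOp H alg η x ^ τ) (weight n p.1 • clientPsi H alg η (x p.1) p.2))
    refine ⟨hint, hle.trans ?_⟩
    obtain ⟨hdecay, hvar⟩ := contraction_bounds (globalOp_isSymmetric hη hn hA)
      (inner_globalOp_self_nonneg hη hn hA) hρ0 hLρ t
    refine add_le_add (hdecay _) (mul_le_mul_of_nonneg_left ?_ (sq_nonneg σ))
    refine (hvar (fun p : Σ i : Fin M, Fin (n i) => weight n p.1 • clientPsi H alg η (x p.1) p.2) _
      (by positivity) (sum_inner_weighted_clientPsi_sq_le hη hni hn hA)).trans ?_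
    rw [hrank, ← hN, hρ]
    refine le_of_eq ?_
    field_simp
  · have h := norm_fBar_sub_sq_le hη hn hA hκ0 hu hLρ (fun i => by positivity) hup fStar j
    have hgap : 0 ≤ modelGap fStar :=
      (norm_nonneg _).trans (le_ciSup (f := fun p : Fin M × Fin M => ‖fStar p.1 - fStar p.2‖)
        (Set.finite_range _).bddAbove (j, j))
    -- Each summand is `(n_i/r_i) dβ/N ≤ νdβ/N`; bounding all `M` of them by the maximum produces
    -- the factor `M` of the final estimate.
    have hsum : ∑ i, weight n i * ((d : ℝ) / r i * β) ≤ M * (ν * d * β / N) := by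
      calc _ ≤ ∑ _i : Fin M, ν * d * β / N := by
            refine Finset.sum_le_sum fun i _ => ?_
            have e : weight n i * ((d : ℝ) / r i * β) = (n i : ℝ) / r i * d * β / N := by
              rw [weight, ← hN]; ring
            rw [e]
            have := hν i
            gcongr
        _ = _ := by simp
    have h2 : ρ * ‖fBar alg η x fStar - fStar j‖ ^ 2 ≤
        ρ * (modelGap fStar * √(2 * κ * β * ν * M * d / (α * N))) ^ 2 := by
      refine h.trans ?_
      rw [mul_pow, Real.sq_sqrt (by positivity)]
      calc _ ≤ alg.localSteps * η * (M * (ν * d * β / N)) * modelGap fStar ^ 2 := by gcongr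
        _ = _ := by rw [hρ]; field_simp
    have h3 := le_of_mul_le_mul_left h2 hρ0
    exact (pow_le_pow_iff_left₀ (norm_nonneg _) (mul_nonneg hgap (Real.sqrt_nonneg _))
      two_ne_zero).mp h3

end Conclusion

/-! ### The Chernoff bound applied to the subspace model. -/

section Probability

attribute [local instance] matrixMeasurableSpace

variable {X H : Type*} [NormedAddCommGroup H] [InnerProductSpace ℝ H]
  [RKHS ℝ H X ℝ] {d M : ℕ} {n r : Fin M → ℕ}

theorem IsSubspaceModel.exists_measurableSet {Ω : Type*} [MeasurableSpace Ω] {μ : Measure Ω}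
    [IsProbabilityMeasure μ] {b : OrthonormalBasis (Fin d) ℝ H}
    {x : Ω → (i : Fin M) → Fin (n i) → X}
    {U : (i : Fin M) → Ω → Matrix (Fin d) (Fin (r i)) ℝ}
    {F : (i : Fin M) → Ω → Matrix (Fin (n i)) (Fin (r i)) ℝ} (h : IsSubspaceModel μ b x U F)
    (hd : 0 < d) (hr : ∀ i, 0 < r i) (hni : ∀ i, 0 < n i) (hn : 0 < ∑ i, n i) {ν : ℝ}
    (hν : ∀ i, (n i : ℝ) / r i ≤ ν) (hν0 : 0 < ν)
    (hN : 40 * ν * d * Real.log d ≤ ((∑ i, n i : ℕ) : ℝ)) :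
    ∃ E : Set Ω, MeasurableSet E ∧ 1 - 1 / (d : ℝ) ≤ μ.real E ∧
      ∀ᵐ ω ∂μ, ω ∈ E → ∀ v : Fin d → ℝ,
        1 / 2 * (v ⬝ᵥ v) ≤
          ∑ i, weight n i * ((d : ℝ) / r i) * (v ⬝ᵥ ((U i ω * (U i ω)ᵀ) *ᵥ v)) := by
  have hd0 : (0 : ℝ) < d := by exact_mod_cast hd
  have hr0 : ∀ i, (0 : ℝ) < r i := fun i => by exact_mod_cast hr i
  have hn0 : ∀ i, (0 : ℝ) < n i := fun i => by exact_mod_cast hni i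
  have hN0 : (0 : ℝ) < ((∑ i, n i : ℕ) : ℝ) := by exact_mod_cast hn
  have hw0 : ∀ i, 0 < weight n i := fun i => div_pos (hn0 i) hN0
  have hm : ∀ i, Measurable fun ω => U i ω * (U i ω)ᵀ := by
    intro i
    refine measurable_matrix_iff.mpr fun k l => ?_
    simp only [mul_apply, transpose_apply]
    exact Finset.measurable_fun_sum _ fun a _ => (h.measurable i k a).mul (h.measurable i l a)
  have hproj : ∀ᵐ ω ∂μ, ∀ i, (U i ω * (U i ω)ᵀ).IsSymm ∧
      U i ω * (U i ω)ᵀ * (U i ω * (U i ω)ᵀ) = U i ω * (U i ω)ᵀ :=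
    h.orthonormal.mono fun ω hω i => isSymm_and_idempotent_of_orthonormal (hω i)
  have hind : iIndepFun (fun i ω => U i ω * (U i ω)ᵀ) μ := by
    have hg : Measurable fun v : Fin d × Fin d → ℝ =>
        (Matrix.of fun k l => v (k, l) : Matrix (Fin d) (Fin d) ℝ) :=
      measurable_matrix_iff.mpr fun k l => measurable_pi_apply (k, l)
    exact h.indep.comp (fun _ v => Matrix.of fun k l => v (k, l)) fun _ => hg
  -- The weights `c_i = w_i d/r_i` cancel the means `r_i/d`, so `∑ c_i p_i = ∑ w_i = 1`; each is at
  -- most `R = νd/N`.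
  obtain ⟨E, hE, hEμ, hEv⟩ := exists_measurableSet_half_le_sum_projections hm hproj hind
    (p := fun i => (r i : ℝ) / d) (c := fun i => weight n i * ((d : ℝ) / r i))
    (fun i => by positivity) (fun i => mul_pos (hw0 i) (div_pos hd0 (hr0 i)))
    (fun i => by ext k l; exact h.isotropic i k l)
    (by
      rw [← sum_weight hn]
      refine Finset.sum_congr rfl fun i _ => ?_
      have := (hr0 i).ne'
      field_simp)
    (R := ν * d / ((∑ i, n i : ℕ) : ℝ)) (by positivity)
    (fun i => by
      have e : weight n i * ((d : ℝ) / r i) = (n i : ℝ) / r i * d / ((∑ i, n i : ℕ) : ℝ) := by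
        rw [weight]; ring
      rw [e]
      have := hν i
      gcongr)
  refine ⟨E, hE, le_trans ?_ hEμ, hEv⟩
  rw [Fintype.card_fin]
  -- This fixes the constant `40 = 2 · 20`: one `log d` cancels the dimension factor in the tail
  -- bound, the other gives the probability `1/d`.
  have hlog : 2 * Real.log d ≤ 1 / (20 * (ν * d / ((∑ i, n i : ℕ) : ℝ))) := by
    rw [le_div_iff₀ (by positivity)]
    have : 2 * Real.log d * (20 * (ν * d / ((∑ i, n i : ℕ) : ℝ))) =
        40 * ν * d * Real.log d / ((∑ i, n i : ℕ) : ℝ) := by ring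
    rw [this, div_le_one hN0]
    exact hN
  have hexp : Real.exp (-(1 / (20 * (ν * d / ((∑ i, n i : ℕ) : ℝ))))) ≤ 1 / (d : ℝ) * (1 / d) := by
    calc _ ≤ Real.exp (-Real.log d + -Real.log d) := Real.exp_le_exp.mpr (by linarith)
      _ = _ := by rw [Real.exp_add, Real.exp_neg, Real.exp_log hd0, one_div]
  have := mul_le_mul_of_nonneg_left hexp hd0.le
  rw [← mul_assoc, mul_one_div_cancel hd0.ne', one_mul] at this
  linarith

end Probability

end FedLearn

theorem mainTheorem7 :
    ∃ C : ℝ, 0 < C ∧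
      ∀ {X H Ω : Type*} [NormedAddCommGroup H] [InnerProductSpace ℝ H] [CompleteSpace H]
        [RKHS ℝ H X ℝ] [MeasurableSpace Ω] (μ : Measure Ω) [IsProbabilityMeasure μ]
        -- the dimension and the orthonormal basis of `H` that forms the feature map
        (d : ℕ) (b : OrthonormalBasis (Fin d) ℝ H)
        -- clients, local data volumes, local subspace dimensions
        (M : ℕ) (_ : 0 < M) (n r : Fin M → ℕ) (_ : ∀ i, 0 < r i)
        -- algorithm, stepsize, initial model, true models, noise level, conditioning
        (alg : FedLearn.Algorithm) (_ : 1 ≤ alg.localSteps) (η : ℝ) (_ : 0 < η)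
        (f₀ : H) (fStar : Fin M → H) (σ α β : ℝ) (_ : 0 < α) (_ : 0 < β)
        -- random covariates, and the conditional law of the noise given the covariates
        (x : Ω → (i : Fin M) → Fin (n i) → X)
        (Q : Kernel Ω ((Σ i : Fin M, Fin (n i)) → ℝ)) [IsMarkovKernel Q]
        (_ : ∀ᵐ ω ∂μ, FedLearn.IsNoiseLaw σ (Q ω))
        -- the subspace model
        (U : (i : Fin M) → Ω → Matrix (Fin d) (Fin (r i)) ℝ)
        (F : (i : Fin M) → Ω → Matrix (Fin (n i)) (Fin (r i)) ℝ)
        (_ : FedLearn.IsSubspaceModel μ b x U F)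
        (_ : ∀ᵐ ω ∂μ, ∀ i, FedLearn.IsConditioned α β (F i ω))
        -- standing assumption `γ < 1`, not needed for FedProx
        (_ : alg ≠ .fedProx → ∀ᵐ ω ∂μ, FedLearn.gammaOf H η (x ω) < 1)
        (N : ℕ) (_ : N = ∑ i, n i) (ν : ℝ) (_ : ν = ⨆ i, (n i : ℝ) / (r i : ℝ))
        (_ : C * ν * d * Real.log d ≤ N),
        ∃ E : Set Ω, MeasurableSet E ∧ 1 - 1 / (d : ℝ) ≤ μ.real E ∧
          ∀ ω ∈ E, ∀ κ : ℝ, κ = alg.kappa (FedLearn.gammaOf H η (x ω)) →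
            ∀ θbar : EuclideanSpace ℝ (Fin d),
              θbar = b.repr (FedLearn.fBar alg η (x ω) fStar) →
            ∀ θ : ℕ → ((Σ i : Fin M, Fin (n i)) → ℝ) → EuclideanSpace ℝ (Fin d),
              θ = (fun t ξ => b.repr (FedLearn.globalModel alg η (x ω)
                (FedLearn.responses (x ω) fStar ξ) f₀ t)) →
            IsUnit (1 - FedLearn.globalOp H alg η (x ω)) ∧
            (∀ t : ℕ,
              Integrable (fun ξ => ‖θ t ξ - θbar‖ ^ 2) (Q ω) ∧
              ∫ ξ, ‖θ t ξ - θbar‖ ^ 2 ∂(Q ω) ≤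
                (1 - alg.localSteps * η * α / (2 * κ)) ^ (2 * t) * ‖b.repr f₀ - θbar‖ ^ 2 +
                  σ ^ 2 * (2 * κ * d / (N * α))) ∧
            ∀ j : Fin M,
              ‖θbar - b.repr (fStar j)‖ ≤
                FedLearn.modelGap fStar * √(2 * κ * β * ν * M * d / (α * N)) := by
  refine ⟨40, by norm_num, ?_⟩
  intro X H Ω _ _ _ _ _ μ _ d b M hM n r hr alg hs η hη f₀ fStar σ α β hα hβ x Q _ hQ U F hU hF hγ
    N hN ν hν hCN
  have i₀ : Fin M := ⟨0, hM⟩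
  -- Positivity of the `n_i` and of `d` does not depend on the sample, so one outcome satisfying the
  -- almost sure hypotheses suffices.
  obtain ⟨ω₀, hω₀, hω₀'⟩ := (hF.and hU.orthonormal).exists
  have hni : ∀ i, 0 < n i := fun i => (hω₀ i).pos hα (hr i)
  have hn : 0 < ∑ i, n i := Finset.sum_pos (fun i _ => hni i) ⟨i₀, Finset.mem_univ _⟩
  have hd : 0 < d := by
    rcases Nat.eq_zero_or_pos d with rfl | h
    · have := congrFun (congrFun (hω₀' i₀) ⟨0, hr i₀⟩) ⟨0, hr i₀⟩
      simp [Matrix.mul_apply] at this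
    · exact h
  have hνi : ∀ i, (n i : ℝ) / r i ≤ ν := fun i => by
    rw [hν]
    exact le_ciSup (f := fun i => (n i : ℝ) / (r i : ℝ)) (Set.finite_range _).bddAbove i
  have hν0 : 0 < ν := lt_of_lt_of_le
    (div_pos (Nat.cast_pos.mpr (hni i₀)) (Nat.cast_pos.mpr (hr i₀))) (hνi i₀)
  obtain ⟨E, hE, hEμ, hEv⟩ := hU.exists_measurableSet hd hr hni hn hνi hν0 (hN ▸ hCN)
  have hgood : ∀ᵐ ω ∂μ, (ω ∈ E → ∀ v : Fin d → ℝ, 1 / 2 * (v ⬝ᵥ v) ≤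
      ∑ i, FedLearn.weight n i * ((d : ℝ) / r i) *
        (v ⬝ᵥ ((U i ω * (U i ω).transpose).mulVec v))) ∧
      FedLearn.IsNoiseLaw σ (Q ω) ∧ (∀ i, FedLearn.IsConditioned α β (F i ω)) ∧
      (∀ i, (U i ω).transpose * U i ω = 1) ∧
      (∀ i, FedLearn.featureMatrix b (x ω i) =
        √((d : ℝ) / (r i : ℝ)) • (F i ω * (U i ω).transpose)) ∧
      (alg ≠ .fedProx → FedLearn.gammaOf H η (x ω) < 1) := by
    have hγ' : ∀ᵐ ω ∂μ, alg ≠ .fedProx → FedLearn.gammaOf H η (x ω) < 1 := by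
      by_cases h : alg = .fedProx
      · exact .of_forall fun ω h' => absurd h h'
      · exact (hγ h).mono fun ω hω _ => hω
    filter_upwards [hEv, hQ, hF, hU.orthonormal, hU.factor, hγ'] with ω h1 h2 h3 h4 h5 h6 using
      ⟨h1, h2, h3, h4, h5, h6⟩
  -- The conclusion is required at every point of the event, so a measurable null set containing all
  -- exceptional outcomes is removed from it, at no cost in probability.
  obtain ⟨G, hGsub, hG, hGμ⟩ := exists_measurable_superset_of_null (ae_iff.mp hgood)
  refine ⟨E \ G, hE.diff hG, ?_, ?_⟩
  · rwa [measureReal_def, measure_sdiff_null hGμ]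
  · rintro ω ⟨hωE, hωG⟩ κ hκ θbar rfl θ rfl
    obtain ⟨h1, h2, h3, h4, h5, h6⟩ := not_not.mp fun h => hωG (hGsub h)
    refine FedLearn.convergence_of_spectral_bounds b hd hni hn alg hs hη f₀ fStar hα hβ h2 h6 ?_
      (fun i f => FedLearn.inner_sampleOp_le_of_factor b (h5 i) (h4 i) hβ.le (h3 i) f) hνi hν0.le
      hκ hN
    intro f
    have h7 := mul_le_mul_of_nonneg_left (h1 hωE (b.repr f).ofLp) hα.le
    rw [FedLearn.dotProduct_repr_self] at h7
    calc α / 2 * ‖f‖ ^ 2 = α * (1 / 2 * ‖f‖ ^ 2) := by ring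
      _ ≤ _ := h7
      _ ≤ _ := by
        rw [Finset.mul_sum]
        refine Finset.sum_le_sum fun i _ => ?_
        have := mul_le_mul_of_nonneg_left
          (FedLearn.le_inner_sampleOp_of_factor b (h5 i) (h3 i) f) (FedLearn.weight_nonneg n i)
        linarith
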